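/- **Networks.** A network with $k$ edge types on a finite set of cells $C$ is given by maps $\sigma_1,\dots,\sigma_k:C\to C$, where $\sigma_i(c)$ is the source of the edge of type $i$ targeting $c$. It is a feed-forward network with layers $C_0,\dots,C_m$ if these sets are non-empty and partition $C$, $\sigma_i(c)=c$ for $c\in C_0$, $\sigma_i(C_l)\subseteq C_{l-1}$ for $1\le l\le m$, every cell of $C_l$ with $l<m$ is $\sigma_i(d)$ for some $i$ and some $d\in C_{l+1}$, and the underlying undirected graph is connected. A coloring (equivalence relation) $\bowtie$ on the cells is balanced if $c\bowtie d$ implies $\sigma_i(c)\bowtie\sigma_i(d)$ for all $i$; the quotient $L/{\bowtie}$ has the $\bowtie$-classes as cells and $\sigma_i^{\bowtie}([c])=[\sigma_i(c)]$. Networks are equal if a bijection of cells commutes with all $\sigma_i$, and $L$ is a lift of $N$ if $N=L/{\bowtie}$ for some balanced $\bowtie$. $L$ is the split of the cell $c$ of $N$ into $c_1,c_2$ if the coloring of $L$ whose only non-trivial class is $\{c_1,c_2\}$ is balanced, with quotient $N$ and $[c_1]=[c_2]=c$. A feed-forward lift $L$ of $N$ with layers $C'_0,\dots,C'_n$ is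 a lift inside $C_j$ if $n=m$, $|C'_j|\ne|C_j|$ and $|C'_i|=|C_i|$ for $i\neq j$. **Systems and branches.** Let $\mathcal V_0$ be the set of smooth $f:\mathbb R\times\mathbb R^k\times\mathbb R\to\mathbb R$ with $f(0,0,\lambda)=0$ for all $\lambda$ and $f_0=0$, where $f_0,f_1,\dots,f_k$ denote the partial derivatives of $f(x_0,x_1,\dots,x_k,\lambda)$ in $x_0,\dots,x_k$ at the origin. Give $\mathcal V_0$ the $C^\infty$ topology (uniform convergence of all derivatives on compact sets); "for generic $f\in\mathcal V_0$" means for all $f$ in some open dense subset of $\mathcal V_0$. An equilibrium branch of $f$ on $L$ is a continuous map $b$ from $D$ to $\mathbb R^{|L|}$, where $D$ is $]-\lambda_0,0]$, $]-\lambda_0,\lambda_0[$ or $[0,\lambda_0[$ for some $\lambda_0>0$, with $b(0)=0$ and $f(b_a(\lambda),b_{\sigma_1(a)}(\lambda),\dots,b_{\sigma_k(a)}(\lambda),\lambda)=0$ for every cell $a$ of $L$ and $\lambda\in D$. It is a bifurcation branch if it does not vanish identically on $D\cap U$ for any neighbourhood $U$ of $0$. It is lifted from $N$ if there is a balanced coloring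 $\bowtie$ of $L$ with $N=L/{\bowtie}$ such that, for all $\lambda\in D$ close enough to $0$, $b_a(\lambda)=b_{a'}(\lambda)$ whenever $a\bowtie a'$. **Proposition.** Let $N$ be a feed-forward network with layers $C_0,\dots,C_m$, let $1<j\le m-1$, and let $L$ be a feed-forward lift of $N$, with layers $C'_0,\dots,C'_m$ and maps $\sigma^L_i$, which is a lift inside $C_j$ and the split of a cell $c\in C_j$ into $c_1,c_2\in C'_j$. Then for generic $f\in\mathcal V_0$ the following holds. For cells $d$ of $L$ put $$w_1^{d}=\sum_{i:\,\sigma^L_i(d)=c_1} f_i,\qquad w_2^{d}=\sum_{i:\,\sigma^L_i(d)=c_2} f_i .$$ If there exist $d',d''\in C'_{j+1}$ such that $\sigma_i^L(d'),\sigma_i^L(d'')\in\{c_1,c_2\}$ for every $1\le i\le k$ and $$w_1^{d'}w_1^{d''}<0,\qquad w_2^{d'}w_2^{d''}<0,\qquad w_1^{d'}w_1^{d''}+w_2^{d'}w_2^{d''}<w_1^{d'}w_2^{d''}+w_1^{d''}w_2^{d'},$$ then every bifurcation branch of $f$ on $L$ is lifted from $N$. -/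

import Mathlib

open scoped ContDiff Topology

noncomputable section

namespace FeedForward

/-! ## Networks, colorings and quotients -/

/-- A network with cells `C` and `k` edge types, each cell being the target of exactly one edge of
each type: `σ i c` is the source of the edge of type `i` that targets `c`. -/
structure Network (k : ℕ) (C : Type*) where
  σ : Fin k → C → C

/-- There is an edge from `c` to `d`. -/
def Network.Edge {k : ℕ} {C : Type*} (N : Network k C) (c d : C) : Prop :=
  ∃ i, N.σ i d = c

/-- Any two cells are joined by a sequence of edges, each traversed in either direction. -/
def Network.Connected {k : ℕ} {C : Type*} (N : Network k C) : Prop :=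
  ∀ c d, Relation.EqvGen N.Edge c d

/-- A bijection of cells that carries one network to the other. -/
structure Network.Iso {k : ℕ} {C C' : Type*} (N : Network k C) (N' : Network k C') where
  toEquiv : C ≃ C'
  map_σ : ∀ i c, toEquiv (N.σ i c) = N'.σ i (toEquiv c)

/-- A coloring is an equivalence relation on the cells; this says that it is balanced. -/
def Network.Balanced {k : ℕ} {C : Type*} (N : Network k C) (r : Setoid C) : Prop :=
  ∀ i c d, r c d → r (N.σ i c) (N.σ i d)

/-- The quotient network of a balanced coloring. -/
def Network.quotient {k : ℕ} {C : Type*} (N : Network k C) (r : Setoid C) (h : N.Balanced r) :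
    Network k (Quotient r) where
  σ i := Quotient.map (N.σ i) (h i)

/-- The coloring whose only class that may have more than one element is `S`. -/
def mergeColoring {C : Type*} (S : Set C) : Setoid C where
  r a b := a = b ∨ (a ∈ S ∧ b ∈ S)
  iseqv := by
    refine ⟨fun a => Or.inl rfl, ?_, ?_⟩
    · rintro a b (rfl | ⟨ha, hb⟩)
      · exact Or.inl rfl
      · exact Or.inr ⟨hb, ha⟩
    · rintro a b c (rfl | ⟨ha, hb⟩) (rfl | ⟨hb', hc⟩)
      · exact Or.inl rfl
      · exact Or.inr ⟨hb', hc⟩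
      · exact Or.inr ⟨ha, hb⟩
      · exact Or.inr ⟨ha, hc⟩

/-- `L` is the split of the cell `c` of `N` into the cells in `S`. -/
def IsSplit {k : ℕ} {C C' : Type*} (N : Network k C) (c : C) (L : Network k C') (S : Set C') :
    Prop :=
  ∃ (h : L.Balanced (mergeColoring S)) (φ : (L.quotient (mergeColoring S) h).Iso N),
    ∀ a ∈ S, φ.toEquiv (Quotient.mk _ a) = c

/-! ## Feed-forward networks -/

/-- A connected feed-forward network with layers `C_j = {c | layer c = j}`, `0 ≤ j ≤ depth`. -/
structure FFN (k : ℕ) (C : Type*) extends Network k C where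
  /-- The index `m` of the last layer. -/
  depth : ℕ
  layer : C → ℕ
  layer_le : ∀ c, layer c ≤ depth
  layer_nonempty : ∀ j ≤ depth, ∃ c, layer c = j
  σ_first : ∀ i c, layer c = 0 → σ i c = c
  σ_succ : ∀ i c j, layer c = j + 1 → layer (σ i c) = j
  exists_target : ∀ c, layer c < depth → ∃ d i, layer d = layer c + 1 ∧ σ i d = c
  connected : toNetwork.Connected

/-- `L` is a lift of `N`: `N` is the quotient of `L` by some balanced coloring. -/
def IsLift {k : ℕ} {C C' : Type*} (N : Network k C) (L : Network k C') : Prop :=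
  ∃ (r : Setoid C') (h : L.Balanced r), Nonempty ((L.quotient r h).Iso N)

/-- `L` is a lift of `N` inside the layer `C_j`. -/
def IsLiftInsideLayer {k : ℕ} {C C' : Type*} (N : FFN k C) (L : FFN k C') (j : ℕ) : Prop :=
  IsLift N.toNetwork L.toNetwork ∧ j ≤ N.depth ∧ N.depth = L.depth ∧
    Set.ncard {a | L.layer a = j} ≠ Set.ncard {a | N.layer a = j} ∧
    ∀ i, i ≠ j → Set.ncard {a | L.layer a = i} = Set.ncard {a | N.layer a = i}

/-! ## Families of coupled cell systems -/

/-- The arguments `(x, (x_1, …, x_k), λ)`. -/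
abbrev Args (k : ℕ) : Type := ℝ × (Fin k → ℝ) × ℝ

/-- The smooth functions `f : ℝ × ℝ^k × ℝ → ℝ` with `f (0, 0, λ) = 0` for every `λ`. -/
structure Family (k : ℕ) where
  toFun : Args k → ℝ
  smooth : ContDiff ℝ ∞ toFun
  zero_eq : ∀ lam : ℝ, toFun (0, 0, lam) = 0

/-- `f_0`, the partial derivative at the origin in the internal variable. -/
def Family.internal {k : ℕ} (f : Family k) : ℝ :=
  deriv (fun t : ℝ => f.toFun (t, 0, 0)) 0

/-- `f_i`, the partial derivative at the origin in the input variable `x_i`. -/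
def Family.input {k : ℕ} (f : Family k) (i : Fin k) : ℝ :=
  deriv (fun t : ℝ => f.toFun (0, Pi.single i t, 0)) 0

/-- The families with a bifurcation condition associated with the internal dynamics: `f_0 = 0`. -/
abbrev InternalFamily (k : ℕ) : Type := {f : Family k // f.internal = 0}

/-- The derivative of order `n` of a family, as a continuous map. -/
def Family.jet {k : ℕ} (f : Family k) (n : ℕ) : C(Args k, Args k [×n]→L[ℝ] ℝ) where
  toFun := iteratedFDeriv ℝ n f.toFun
  continuous_toFun := f.smooth.continuous_iteratedFDeriv (by exact_mod_cast le_top)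

/-- The `C^∞` topology: uniform convergence on compact sets of the derivatives of all orders. -/
instance Family.topology (k : ℕ) : TopologicalSpace (Family k) :=
  TopologicalSpace.induced (fun f (n : ℕ) => f.jet n) inferInstance

/-- A property holds generically if it holds on an open dense set. -/
def Generically {X : Type*} [TopologicalSpace X] (P : X → Prop) : Prop :=
  ∃ G : Set X, IsOpen G ∧ Dense G ∧ ∀ f ∈ G, P f

/-- The admissible vector field `f^N` at `(x, λ)`. -/
def Family.field {k : ℕ} {C : Type*} (f : Family k) (N : Network k C) (x : C → ℝ) (lam : ℝ) :
    C → ℝ :=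
  fun c => f.toFun (x c, fun i => x (N.σ i c), lam)

/-- The total weight of the edges from `a` to `d`: the sum of the `f_i` with `σ_i d = a`. -/
def weight {k : ℕ} {C : Type*} (f : Family k) (N : Network k C) (a d : C) : ℝ :=
  open Classical in ∑ i with N.σ i d = a, f.input i

/-! ## Bifurcation branches -/

/-- `D` is one of `]-λ₀, 0]`, `]-λ₀, λ₀[`, `[0, λ₀[` with `λ₀ > 0`. -/
def IsDomain (D : Set ℝ) : Prop :=
  ∃ l > 0, D = Set.Ioc (-l) 0 ∨ D = Set.Ioo (-l) l ∨ D = Set.Ico 0 l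

/-- `b : D → ℝ^C` is an equilibrium branch of `f` on `N`, from the origin at `λ = 0`. Only the values
of `b` on `D` matter. A branch is not smooth at `0` in general (for example of order `√λ`), so
continuity is all that is asked for. -/
structure IsEquilibriumBranch {k : ℕ} {C : Type*} (f : Family k) (N : Network k C)
    (D : Set ℝ) (b : ℝ → C → ℝ) : Prop where
  domain : IsDomain D
  continuousOn : ContinuousOn b D
  zero_eq : b 0 = 0
  field_eq : ∀ lam ∈ D, f.field N (b lam) lam = 0

/-- An equilibrium branch whose germ at `0` is not that of the trivial branch. -/
def IsBifurcationBranch {k : ℕ} {C : Type*} (f : Family k) (N : Network k C)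
    (D : Set ℝ) (b : ℝ → C → ℝ) : Prop :=
  IsEquilibriumBranch f N D b ∧ ¬ ∀ᶠ lam in 𝓝[D] (0 : ℝ), b lam = 0

/-- The polydiagonal subspace of a coloring. -/
def polydiagonal {C : Type*} (r : Setoid C) : Submodule ℝ (C → ℝ) where
  carrier := {x | ∀ c d, r c d → x c = x d}
  add_mem' hx hy c d h := by simp [hx c d h, hy c d h]
  zero_mem' _ _ _ := rfl
  smul_mem' a x hx c d h := by simp [hx c d h]

/-- The germ at `0` of the branch `b : D → ℝ^C'` on `L` is lifted from `N`. -/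
def IsLiftedFrom {k : ℕ} {C C' : Type*} (N : Network k C) (L : Network k C')
    (D : Set ℝ) (b : ℝ → C' → ℝ) : Prop :=
  ∃ (r : Setoid C') (h : L.Balanced r), Nonempty ((L.quotient r h).Iso N) ∧
    ∀ᶠ lam in 𝓝[D] (0 : ℝ), b lam ∈ polydiagonal r

end FeedForward

end

namespace FeedForward

/-! ## Non-vanishing of nested square roots -/

/-- The sums `∑ i, a i * c i a` where each `c i` is zero or belongs to `T`, at least one of them
belonging to `T`. -/
def inputSums {k : ℕ} (T : Set ((Fin k → ℝ) → ℝ)) : Set ((Fin k → ℝ) → ℝ) :=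
  {e | ∃ c : Fin k → (Fin k → ℝ) → ℝ, (∀ i, c i = 0 ∨ c i ∈ T) ∧ (∃ i, c i ∈ T) ∧
    e = fun a => ∑ i, a i * c i a}

/-- The possible normalized leading coefficients of branches of order `λ ^ (1 / 2 ^ p)`, as
functions of the linear input coefficients. -/
def leadingCoeffs (k : ℕ) : ℕ → Set ((Fin k → ℝ) → ℝ)
  | 0 => {fun _ => 1, fun _ => -1}
  | p + 1 => {t | ∃ e ∈ inputSums (leadingCoeffs k p),
      t = (fun a => √|e a|) ∨ t = fun a => -√|e a|}

theorem inputSums_finite {k : ℕ} {T : Set ((Fin k → ℝ) → ℝ)} (hT : T.Finite) :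
    (inputSums T).Finite := by
  have h : (Set.univ.pi fun _ : Fin k => insert (0 : (Fin k → ℝ) → ℝ) T).Finite :=
    Set.Finite.pi fun _ => hT.insert _
  refine (h.image fun c a => ∑ i, a i * c i a).subset ?_
  rintro e ⟨c, hc, -, rfl⟩
  exact ⟨c, fun i _ => hc i, rfl⟩

theorem inputSums_continuous {k : ℕ} {T : Set ((Fin k → ℝ) → ℝ)} (hT : ∀ t ∈ T, Continuous t) :
    ∀ e ∈ inputSums T, Continuous e := by
  rintro e ⟨c, hc, -, rfl⟩
  refine continuous_finsetSum _ fun i _ => (continuous_apply i).mul ?_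
  rcases hc i with h | h
  · rw [h]; exact continuous_const
  · exact hT _ h

theorem leadingCoeffs_finite (k p : ℕ) : (leadingCoeffs k p).Finite := by
  induction p with
  | zero => exact Set.toFinite {fun _ => 1, fun _ => -1}
  | succ p ih =>
    have h := inputSums_finite ih
    refine ((h.image fun e a => √|e a|).union (h.image fun e a => -√|e a|)).subset ?_
    rintro t ⟨e, he, rfl | rfl⟩
    · exact Or.inl ⟨e, he, rfl⟩
    · exact Or.inr ⟨e, he, rfl⟩

theorem leadingCoeffs_continuous (k p : ℕ) : ∀ t ∈ leadingCoeffs k p, Continuous t := by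
  induction p with
  | zero =>
    rintro t (rfl | rfl)
    · exact continuous_const
    · exact continuous_const
  | succ p ih =>
    rintro t ⟨e, he, rfl | rfl⟩
    · exact (inputSums_continuous ih e he).abs.sqrt
    · exact (inputSums_continuous ih e he).abs.sqrt.neg

/-- The linear input coefficients for which no sum of leading coefficients up to order `m`
cancels. -/
def nonresonant (k m : ℕ) : Set (Fin k → ℝ) :=
  {a | ∀ p ≤ m, ∀ e ∈ inputSums (leadingCoeffs k p), e a ≠ 0}

theorem isOpen_nonresonant (k m : ℕ) : IsOpen (nonresonant k m) := by
  have : nonresonant k m =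
      ⋂ p ∈ Set.Iic m, ⋂ e ∈ inputSums (leadingCoeffs k p), {a | e a ≠ 0} := by
    ext a; simp [nonresonant]
  rw [this]
  refine (Set.finite_Iic m).isOpen_biInter fun p _ =>
    (inputSums_finite (leadingCoeffs_finite k p)).isOpen_biInter fun e he => ?_
  exact isOpen_ne_fun (inputSums_continuous (leadingCoeffs_continuous k p) e he) continuous_const

/-! ### A valuation on the reals that extends the `2`-adic one -/

theorem exists_valuation_two_lt_one : ∃ V : ValuationSubring ℝ, V.valuation 2 < 1 := by
  let I : Ideal (⊥ : Subring ℝ) := Ideal.span {2}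
  have hI : I ≠ ⊤ := by
    rw [Ideal.ne_top_iff_one]
    intro h
    obtain ⟨⟨c, hc⟩, h⟩ := Ideal.mem_span_singleton'.1 h
    obtain ⟨n, rfl⟩ := Subring.mem_bot.1 hc
    have h' : (n : ℝ) * 2 = 1 := congrArg Subtype.val h
    have : n * 2 = 1 := by exact_mod_cast h'
    omega
  obtain ⟨V, -, hV⟩ := Ideal.image_subset_nonunits_valuationSubring I hI
  exact ⟨V, V.mem_nonunits_iff.1 (hV ⟨2, Ideal.subset_span rfl, rfl⟩)⟩

theorem valuation_odd {V : ValuationSubring ℝ} (hV : V.valuation 2 < 1) {n : ℤ} (hn : Odd n) :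
    V.valuation (n : ℝ) = 1 := by
  obtain ⟨m, rfl⟩ := hn
  have hm : V.valuation (m : ℝ) ≤ 1 := (V.valuation_le_one_iff _).2 (intCast_mem V m)
  have h : V.valuation (2 * (m : ℝ)) < V.valuation 1 := by
    rw [map_mul, map_one]
    exact mul_lt_one_of_lt_of_le hV hm
  push_cast
  rw [Valuation.map_add_eq_of_lt_right _ h, map_one]

theorem dense_two_pow_mul_odd_div_odd (n : ℕ) :
    Dense {x : ℝ | ∃ a b : ℤ, Odd a ∧ Odd b ∧ x = 2 ^ n * a / b} := by
  rw [Metric.dense_iff]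
  intro x r hr
  obtain ⟨N, hN⟩ := exists_nat_gt ((2 : ℝ) ^ n / r)
  have hb : (0 : ℝ) < 2 * N + 1 := by positivity
  set q : ℝ := x * (2 * N + 1) / (2 ^ n * 2) with hq
  refine ⟨2 ^ n * ((2 * ⌊q⌋ + 1 : ℤ) : ℝ) / ((2 * N + 1 : ℤ) : ℝ), ?_,
    2 * ⌊q⌋ + 1, 2 * N + 1, odd_two_mul_add_one _, odd_two_mul_add_one _, rfl⟩
  have hp : (0 : ℝ) < 2 ^ n := by positivity
  have hx : x = 2 ^ n * 2 * q / (2 * N + 1) := by rw [hq]; field_simp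
  rw [Metric.mem_ball, Real.dist_eq]
  push_cast
  have h1 : 2 ^ n * (2 * (⌊q⌋ : ℝ) + 1) / (2 * N + 1) - x
      = 2 ^ n * (2 * (⌊q⌋ - q) + 1) / (2 * N + 1) := by
    rw [hx]; ring
  have h2 : |2 * ((⌊q⌋ : ℝ) - q) + 1| ≤ 1 := by
    have := Int.floor_le q
    have := Int.lt_floor_add_one q
    rw [abs_le]; constructor <;> linarith
  rw [h1, abs_div, abs_mul, abs_of_pos hp, abs_of_pos hb, div_lt_iff₀ hb]
  rw [div_lt_iff₀ hr] at hN
  nlinarith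

theorem sum_mul_pow_injective {k B : ℕ} {e e' : Fin k → ℕ} (he : ∀ i, e i < B)
    (he' : ∀ i, e' i < B) (h : ∑ i, e i * B ^ (i : ℕ) = ∑ i, e' i * B ^ (i : ℕ)) : e = e' := by
  have h' : finFunctionFinEquiv (fun i => (⟨e i, he i⟩ : Fin B)) =
      finFunctionFinEquiv (fun i => (⟨e' i, he' i⟩ : Fin B)) := by
    apply Fin.ext
    simpa [finFunctionFinEquiv_apply] using h
  funext i
  simpa using congrFun (finFunctionFinEquiv.injective h') i

theorem exists_valuation_sum_eq {K Γ ι : Type*} [Field K] [LinearOrderedCommGroupWithZero Γ]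
    (v : Valuation K Γ) (s : Finset ι) (x : ι → K) (hs : s.Nonempty)
    (hx : ∀ i ∈ s, ∀ j ∈ s, v (x i) = v (x j) → i = j) :
    ∃ i ∈ s, v (∑ j ∈ s, x j) = v (x i) := by
  classical
  obtain ⟨i, hi, hmax⟩ := s.exists_max_image (fun j => v (x j)) hs
  refine ⟨i, hi, Valuation.map_sum_eq_of_lt _ hi fun j hj => ?_⟩
  simp only [Finset.mem_sdiff, Finset.mem_singleton] at hj
  exact lt_of_le_of_ne (hmax j hj.1) fun h => hj.2 (hx j hj.1 i hi h)

section Valuation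

variable {k B : ℕ} {V : ValuationSubring ℝ} {a : Fin k → ℝ}

theorem inputSums_valuation (hV : V.valuation 2 < 1)
    (ha : ∀ i, V.valuation (a i) = V.valuation 2 ^ B ^ (i : ℕ)) {p : ℕ} (hp : 2 ^ (p + 1) ≤ B)
    {T : Set ((Fin k → ℝ) → ℝ)}
    (hT : ∀ t ∈ T, ∃ e : Fin k → ℕ, ∑ i, e i < 2 ^ p ∧
      V.valuation (t a) ^ 2 ^ p = V.valuation 2 ^ ∑ i, e i * B ^ (i : ℕ))
    {s : (Fin k → ℝ) → ℝ} (hs : s ∈ inputSums T) :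
    ∃ e : Fin k → ℕ, ∑ i, e i < 2 ^ (p + 1) ∧
      V.valuation (s a) ^ 2 ^ p = V.valuation 2 ^ ∑ i, e i * B ^ (i : ℕ) := by
  classical
  obtain ⟨c, hc, ⟨i₀, hi₀⟩, rfl⟩ := hs
  have h2 : V.valuation 2 ≠ 0 := by simp
  have hterm : ∀ i, c i ∈ T → ∃ e : Fin k → ℕ, ∑ l, e l < 2 ^ (p + 1) ∧ 2 ^ p ≤ e i ∧
      (∀ l ≠ i, e l < 2 ^ p) ∧
      V.valuation (a i * c i a) ^ 2 ^ p = V.valuation 2 ^ ∑ l, e l * B ^ (l : ℕ) := by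
    intro i hi
    obtain ⟨e, he, hv⟩ := hT _ hi
    refine ⟨e + Pi.single i (2 ^ p), ?_, by simp, fun l hl => ?_, ?_⟩
    · simp only [Pi.add_apply, Finset.sum_add_distrib, Finset.sum_pi_single', Finset.mem_univ,
        if_true]
      rw [pow_succ]; omega
    · have : e l ≤ ∑ i, e i := Finset.single_le_sum (fun _ _ => Nat.zero_le _) (Finset.mem_univ l)
      simp [hl]; omega
    · have : ∑ l, (Pi.single i (2 ^ p) : Fin k → ℕ) l * B ^ (l : ℕ) = B ^ (i : ℕ) * 2 ^ p := by
        rw [Finset.sum_eq_single i] <;> simp +contextual [mul_comm]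
      simp only [Pi.add_apply, add_mul, Finset.sum_add_distrib]
      rw [this, map_mul, mul_pow, hv, ha, ← pow_mul, ← pow_add, add_comm]
  let I : Finset (Fin k) := Finset.univ.filter fun i => c i ∈ T
  have hsum : ∑ i, a i * c i a = ∑ i ∈ I, a i * c i a := by
    symm
    refine Finset.sum_subset (Finset.subset_univ _) fun i _ hi => ?_
    have : c i = 0 := (hc i).resolve_right fun h => hi (by simp [I, h])
    simp [this]
  obtain ⟨i, hi, h⟩ := exists_valuation_sum_eq V.valuation I (fun i => a i * c i a)
    ⟨i₀, by simp [I, hi₀]⟩ (by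
      intro i hi j hj hij
      obtain ⟨e, hes, hei, -, hev⟩ := hterm i (by simpa [I] using hi)
      obtain ⟨e', hes', -, hel', hev'⟩ := hterm j (by simpa [I] using hj)
      by_contra hne
      rw [hij, hev'] at hev
      have hinj := pow_right_injective₀ (zero_lt_iff.2 h2) hV.ne hev
      have hlt : ∀ l, e l < B := fun l =>
        (Finset.single_le_sum (f := e) (fun _ _ => Nat.zero_le _) (Finset.mem_univ l)).trans_lt
          (hes.trans_le hp)
      have hlt' : ∀ l, e' l < B := fun l =>
        (Finset.single_le_sum (f := e') (fun _ _ => Nat.zero_le _) (Finset.mem_univ l)).trans_lt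
          (hes'.trans_le hp)
      have := congrFun (sum_mul_pow_injective hlt' hlt hinj) i
      have := hel' i hne
      omega)
  obtain ⟨e, hes, -, -, hev⟩ := hterm i (by simpa [I] using hi)
  refine ⟨e, hes, ?_⟩
  simp only [hsum]
  rw [h, hev]

theorem leadingCoeffs_valuation (hV : V.valuation 2 < 1)
    (ha : ∀ i, V.valuation (a i) = V.valuation 2 ^ B ^ (i : ℕ)) (p : ℕ) (hp : 2 ^ p ≤ B) :
    ∀ t ∈ leadingCoeffs k p, ∃ e : Fin k → ℕ, ∑ i, e i < 2 ^ p ∧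
      V.valuation (t a) ^ 2 ^ p = V.valuation 2 ^ ∑ i, e i * B ^ (i : ℕ) := by
  induction p with
  | zero =>
    rintro t (rfl | rfl)
    · exact ⟨0, by simp, by simp⟩
    · exact ⟨0, by simp, by simp [Valuation.map_neg]⟩
  | succ p ih =>
    have ih := ih ((Nat.pow_le_pow_right two_pos p.le_succ).trans hp)
    intro t ht
    obtain ⟨s, hs, ht⟩ := ht
    obtain ⟨e, he, hev⟩ := inputSums_valuation hV ha hp ih hs
    refine ⟨e, he, ?_⟩
    have habs : V.valuation |s a| = V.valuation (s a) := by
      rcases abs_choice (s a) with h | h <;> rw [h]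
      exact Valuation.map_neg _ _
    have hsq : V.valuation (t a) ^ 2 = V.valuation (s a) := by
      rw [← map_pow, ← habs]
      congr 1
      rcases ht with rfl | rfl
      · exact Real.sq_sqrt (abs_nonneg _)
      · simp only [neg_sq]
        exact Real.sq_sqrt (abs_nonneg _)
    rw [pow_succ', pow_mul, hsq, hev]

end Valuation

theorem dense_nonresonant (k m : ℕ) : Dense (nonresonant k m) := by
  obtain ⟨V, hV⟩ := exists_valuation_two_lt_one
  have hd : Dense (Set.univ.pi fun i : Fin k =>
      {x : ℝ | ∃ a b : ℤ, Odd a ∧ Odd b ∧ x = 2 ^ ((2 ^ (m + 1)) ^ (i : ℕ)) * a / b}) :=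
    dense_pi _ fun i _ => dense_two_pow_mul_odd_div_odd _
  refine hd.mono fun a ha => ?_
  have hv : ∀ i, V.valuation (a i) = V.valuation 2 ^ (2 ^ (m + 1)) ^ (i : ℕ) := by
    intro i
    obtain ⟨x, y, hx, hy, h⟩ := ha i (Set.mem_univ i)
    rw [h, map_div₀, map_mul, map_pow, valuation_odd hV hx, valuation_odd hV hy, mul_one, div_one]
  intro p hp s hs h0
  obtain ⟨e, -, he⟩ := inputSums_valuation hV hv (p := p)
    (Nat.pow_le_pow_right two_pos (by omega))
    (leadingCoeffs_valuation hV hv p (Nat.pow_le_pow_right two_pos (by omega))) hs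
  rw [h0, map_zero, zero_pow (by positivity)] at he
  exact pow_ne_zero _ (by simp) he.symm

end FeedForward

noncomputable section

namespace FeedForward

/-! ## Second order coefficients and genericity of families -/

namespace Family

variable {k : ℕ}

/-- The partial derivative of a family in the internal variable. -/
def internalDeriv (f : Family k) (z : Args k) : ℝ :=
  fderiv ℝ f.toFun z (1, 0, 0)

/-- The derivative at the origin of the partial derivative in the internal variable. -/
def internalHessian (f : Family k) (v : Args k) : ℝ :=
  fderiv ℝ f.internalDeriv 0 v

theorem differentiable (f : Family k) : Differentiable ℝ f.toFun :=
  f.smooth.differentiable (by simp)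

theorem internalDeriv_differentiable (f : Family k) : Differentiable ℝ f.internalDeriv :=
  ((contDiff_infty_iff_fderiv.1 f.smooth).2.differentiable
    (by simp)).clm_apply (differentiable_const _)

theorem internal_eq_fderiv (f : Family k) : f.internal = fderiv ℝ f.toFun 0 (1, 0, 0) := by
  have h1 : HasDerivAt (fun t : ℝ => ((t, 0, 0) : Args k)) (1, 0, 0) 0 :=
    (hasDerivAt_id 0).prodMk (hasDerivAt_const 0 _)
  exact ((f.differentiable (0, 0, 0)).hasFDerivAt.comp_hasDerivAt (0 : ℝ) h1).deriv

theorem input_eq_fderiv (f : Family k) (i : Fin k) :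
    f.input i = fderiv ℝ f.toFun 0 (0, Pi.single i 1, 0) := by
  have h0 : HasDerivAt (fun t : ℝ => (Pi.single i t : Fin k → ℝ)) (Pi.single i 1) 0 := by
    refine hasDerivAt_pi.2 fun l => ?_
    by_cases h : l = i
    · subst h; simpa using hasDerivAt_id' (0 : ℝ)
    · simpa [h] using hasDerivAt_const (0 : ℝ) (0 : ℝ)
  have h1 : HasDerivAt (fun t : ℝ => ((0, Pi.single i t, 0) : Args k)) (0, Pi.single i 1, 0) 0 :=
    (hasDerivAt_const 0 _).prodMk (h0.prodMk (hasDerivAt_const 0 _))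
  have h2 : HasFDerivAt f.toFun (fderiv ℝ f.toFun 0) ((0, Pi.single i 0, 0) : Args k) := by
    have : ((0, Pi.single i 0, 0) : Args k) = 0 := by simp
    rw [this]; exact (f.differentiable 0).hasFDerivAt
  exact (h2.comp_hasDerivAt (0 : ℝ) h1).deriv

theorem internalHessian_eq_jet (f : Family k) (v : Args k) :
    f.internalHessian v = f.jet 2 0 ![v, (1, 0, 0)] := by
  have h : DifferentiableAt ℝ (fderiv ℝ f.toFun) 0 :=
    (contDiff_infty_iff_fderiv.1 f.smooth).2.differentiable (by simp) 0
  change _ = iteratedFDeriv ℝ 2 f.toFun 0 ![v, (1, 0, 0)]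
  rw [iteratedFDeriv_two_apply]
  change fderiv ℝ (fun z => fderiv ℝ f.toFun z (1, 0, 0)) 0 v = _
  rw [fderiv_clm_apply h (differentiableAt_const _)]
  simp

theorem continuous_jet_apply (n : ℕ) (m : Fin n → Args k) :
    Continuous fun f : Family k => f.jet n 0 m := by
  have h1 : Continuous fun (f : Family k) (n : ℕ) => f.jet n := continuous_induced_dom
  have h2 : Continuous fun f : Family k => f.jet n 0 :=
    (continuous_eval_const (0 : Args k)).comp ((continuous_apply n).comp h1)
  exact (ContinuousMultilinearMap.apply ℝ (fun _ : Fin n => Args k) ℝ m).continuous.comp h2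

theorem continuous_input : Continuous fun f : Family k => f.input := by
  refine continuous_pi fun i => ?_
  have : (fun f : Family k => f.input i) =
      fun f => f.jet 1 0 fun _ => (0, Pi.single i 1, 0) := by
    funext f
    rw [input_eq_fderiv]
    exact (iteratedFDeriv_one_apply (𝕜 := ℝ) (f := f.toFun) (x := 0)
      fun _ => (0, Pi.single i 1, 0)).symm
  rw [this]
  exact continuous_jet_apply _ _

theorem continuous_internalHessian (v : Args k) :
    Continuous fun f : Family k => f.internalHessian v := by
  simp only [internalHessian_eq_jet]
  exact continuous_jet_apply _ _

/-- The family `x_i`. -/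
def inputMonomial (i : Fin k) : Family k where
  toFun z := z.2.1 i
  smooth := by fun_prop
  zero_eq _ := rfl

/-- The family `x_0 ^ 2`. -/
def squareMonomial : Family k where
  toFun z := z.1 ^ 2
  smooth := by fun_prop
  zero_eq _ := by simp

/-- The family `x_0 * λ`. -/
def mixedMonomial : Family k where
  toFun z := z.1 * z.2.2
  smooth := by fun_prop
  zero_eq _ := by simp

/-- A polynomial perturbation of a family. -/
def perturb (f : Family k) (u : (Fin k → ℝ) × ℝ × ℝ) : Family k where
  toFun z := f.toFun z + (∑ i, u.1 i * z.2.1 i) + u.2.1 * z.1 ^ 2 + u.2.2 * (z.1 * z.2.2)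
  smooth := by
    have := f.smooth
    fun_prop
  zero_eq lam := by simp [f.zero_eq]

theorem perturb_zero (f : Family k) : f.perturb 0 = f := by
  cases f; simp [perturb]

theorem jet_perturb (f : Family k) (u : (Fin k → ℝ) × ℝ × ℝ) (n : ℕ) :
    (f.perturb u).jet n = f.jet n + (∑ i, u.1 i • (inputMonomial i).jet n) +
      u.2.1 • squareMonomial.jet n + u.2.2 • mixedMonomial.jet n := by
  ext1 z
  have hs : ∀ g : Family k, ContDiffAt ℝ n g.toFun z := fun g =>
    (g.smooth.of_le (by exact_mod_cast le_top)).contDiffAt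
  have hc : ∀ (c : ℝ) (g : Family k), ContDiffAt ℝ n (c • g.toFun) z := fun c g =>
    contDiffAt_const.smul (hs g)
  have h1 : (f.perturb u).toFun = f.toFun + (∑ i, u.1 i • (inputMonomial i).toFun) +
      u.2.1 • squareMonomial.toFun + u.2.2 • mixedMonomial.toFun := by
    funext z
    simp [perturb, inputMonomial, squareMonomial, mixedMonomial]
  have hsum : ContDiffAt ℝ n (∑ i, u.1 i • (inputMonomial i).toFun) z := by
    have : (∑ i, u.1 i • (inputMonomial i).toFun : Args k → ℝ) =
        fun z => ∑ i, (u.1 i • (inputMonomial i).toFun) z := by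
      funext z; simp
    rw [this]
    exact ContDiffAt.sum fun i _ => hc _ _
  have h2 : ContDiffAt ℝ n (f.toFun + ∑ i, u.1 i • (inputMonomial i).toFun) z := (hs f).add hsum
  have h3 : ContDiffAt ℝ n (f.toFun + ∑ i, u.1 i • (inputMonomial i).toFun +
      u.2.1 • squareMonomial.toFun) z := h2.add (hc _ _)
  have hsum' : iteratedFDeriv ℝ n (∑ i, u.1 i • (inputMonomial i).toFun) z =
      ∑ i, u.1 i • iteratedFDeriv ℝ n (inputMonomial i).toFun z := by
    rw [iteratedFDeriv_sum_apply fun i _ => hc _ _]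
    exact Finset.sum_congr rfl fun i _ => iteratedFDeriv_const_smul_apply (hs _)
  change iteratedFDeriv ℝ n (f.perturb u).toFun z = _
  rw [h1, iteratedFDeriv_add_apply h3 (hc _ _),
    iteratedFDeriv_add_apply h2 (hc _ _), iteratedFDeriv_add_apply (hs f) hsum,
    hsum', iteratedFDeriv_const_smul_apply (hs _), iteratedFDeriv_const_smul_apply (hs _)]
  simp [jet]

theorem continuous_perturb (f : Family k) : Continuous f.perturb := by
  refine continuous_induced_rng.2 (continuous_pi fun n => ?_)
  simp only [Function.comp_def, jet_perturb]
  fun_prop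

theorem fderiv_perturb (f : Family k) (u : (Fin k → ℝ) × ℝ × ℝ) (z v : Args k) :
    fderiv ℝ (f.perturb u).toFun z v = fderiv ℝ f.toFun z v + (∑ i, u.1 i * v.2.1 i) +
      u.2.1 * (2 * z.1 * v.1) + u.2.2 * (z.1 * v.2.2 + v.1 * z.2.2) := by
  have h1 : HasFDerivAt (fun z : Args k => z.1) (ContinuousLinearMap.fst ℝ ℝ _) z :=
    hasFDerivAt_fst
  have h2 : HasFDerivAt (fun z : Args k => z.2)
      (ContinuousLinearMap.snd ℝ ℝ ((Fin k → ℝ) × ℝ)) z := hasFDerivAt_snd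
  have h3 := h2.snd
  have h4 : ∀ i, HasFDerivAt (fun z : Args k => z.2.1 i)
      ((ContinuousLinearMap.proj i).comp ((ContinuousLinearMap.fst ℝ (Fin k → ℝ) ℝ).comp
        (ContinuousLinearMap.snd ℝ ℝ ((Fin k → ℝ) × ℝ)))) z := fun i =>
    ((ContinuousLinearMap.proj (R := ℝ) (φ := fun _ : Fin k => ℝ) i).comp
      ((ContinuousLinearMap.fst ℝ (Fin k → ℝ) ℝ).comp
        (ContinuousLinearMap.snd ℝ ℝ ((Fin k → ℝ) × ℝ)))).hasFDerivAt
  have h := (((f.differentiable z).hasFDerivAt.add (HasFDerivAt.fun_sum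
    (u := Finset.univ) fun i _ => (h4 i).const_mul (u.1 i))).add
      ((h1.pow 2).const_mul u.2.1)).add ((h1.mul h3).const_mul u.2.2)
  have h' : HasFDerivAt (f.perturb u).toFun _ z := h
  rw [h'.fderiv]
  simp
  ring

theorem internal_perturb (f : Family k) (u : (Fin k → ℝ) × ℝ × ℝ) :
    (f.perturb u).internal = f.internal := by
  simp [internal_eq_fderiv, fderiv_perturb]

theorem input_perturb (f : Family k) (u : (Fin k → ℝ) × ℝ × ℝ) :
    (f.perturb u).input = f.input + u.1 := by
  funext i
  rw [Pi.add_apply, input_eq_fderiv, fderiv_perturb, input_eq_fderiv,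
    Finset.sum_eq_single i] <;> simp +contextual

theorem internalHessian_perturb (f : Family k) (u : (Fin k → ℝ) × ℝ × ℝ) (v : Args k) :
    (f.perturb u).internalHessian v =
      f.internalHessian v + 2 * u.2.1 * v.1 + u.2.2 * v.2.2 := by
  have h0 : (f.perturb u).internalDeriv =
      fun z => f.internalDeriv z + 2 * u.2.1 * z.1 + u.2.2 * z.2.2 := by
    funext z
    simp [internalDeriv, fderiv_perturb]
    ring
  have h1 : HasFDerivAt (fun z : Args k => z.1) (ContinuousLinearMap.fst ℝ ℝ _) 0 :=
    hasFDerivAt_fst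
  have h2 : HasFDerivAt (fun z : Args k => z.2)
      (ContinuousLinearMap.snd ℝ ℝ ((Fin k → ℝ) × ℝ)) 0 := hasFDerivAt_snd
  have h := ((f.internalDeriv_differentiable 0).hasFDerivAt.add
    (h1.const_mul (2 * u.2.1))).add (h2.snd.const_mul u.2.2)
  rw [internalHessian, h0]
  erw [h.fderiv]
  simp [internalHessian]

/-- The second derivative `f_00` at the origin. -/
def quadratic (f : Family k) : ℝ := f.internalHessian (1, 0, 0)

/-- The mixed second derivative in the internal variable and the parameter at the origin. -/
def mixed (f : Family k) : ℝ := f.internalHessian (0, 0, 1)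

/-- The non-degeneracy conditions on a family, on networks of depth at most `m`. -/
structure NonDegenerate (f : Family k) (m : ℕ) : Prop where
  internal : f.internal = 0
  input_mem : f.input ∈ nonresonant k m
  quadratic_ne : f.quadratic ≠ 0
  mixed_ne : f.mixed ≠ 0

theorem generically_nonDegenerate (k m : ℕ) :
    Generically fun f : InternalFamily k => f.1.NonDegenerate m := by
  refine ⟨{f | f.1.input ∈ nonresonant k m ∧ f.1.quadratic ≠ 0 ∧ f.1.mixed ≠ 0}, ?_, ?_,
    fun f hf => ⟨f.2, hf.1, hf.2.1, hf.2.2⟩⟩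
  · exact ((isOpen_nonresonant k m).preimage (continuous_input.comp continuous_subtype_val)).inter
      ((isOpen_ne_fun ((continuous_internalHessian _).comp continuous_subtype_val)
        continuous_const).inter
      (isOpen_ne_fun ((continuous_internalHessian _).comp continuous_subtype_val)
        continuous_const))
  · intro f
    let Φ : (Fin k → ℝ) × ℝ × ℝ → InternalFamily k := fun u =>
      ⟨f.1.perturb u, (internal_perturb f.1 u).trans f.2⟩
    have hΦ : Continuous Φ := (continuous_perturb f.1).subtype_mk _
    have hΦ0 : Φ 0 = f := Subtype.ext (perturb_zero f.1)
    have h1 : Dense {u : Fin k → ℝ | f.1.input + u ∈ nonresonant k m} :=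
      (dense_nonresonant k m).preimage (Homeomorph.addLeft f.1.input).isOpenMap
    have h2 : Dense {α : ℝ | α ≠ -f.1.quadratic / 2} := dense_compl_singleton _
    have h3 : Dense {β : ℝ | β ≠ -f.1.mixed} := dense_compl_singleton _
    have := map_mem_closure hΦ ((h1.prod (h2.prod h3)) 0)
      (t := {f | f.1.input ∈ nonresonant k m ∧ f.1.quadratic ≠ 0 ∧ f.1.mixed ≠ 0}) (by
        rintro ⟨u, α, β⟩ ⟨hu, hα, hβ⟩
        refine ⟨?_, fun h => hα ?_, fun h => hβ ?_⟩
        · simpa [Φ, input_perturb] using hu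
        · simp only [Φ, quadratic, internalHessian_perturb] at h ⊢
          linarith
        · simp only [Φ, mixed, internalHessian_perturb] at h ⊢
          linarith)
    rwa [hΦ0] at this

end Family

end FeedForward

end

noncomputable section

namespace FeedForward

/-! ## Expansion of a family at the bifurcation point -/

namespace Family

open Filter Asymptotics

variable {k : ℕ}

theorem fderiv_input_direction (f : Family k) (y : Fin k → ℝ) :
    fderiv ℝ f.toFun 0 (0, y, 0) = ∑ i, f.input i * y i := by
  have h : ((0, y, 0) : Args k) = ∑ i, y i • ((0, Pi.single i 1, 0) : Args k) := by
    refine Prod.ext ?_ (Prod.ext ?_ ?_)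
    · simp [Prod.fst_sum]
    · simp only [Prod.snd_sum, Prod.fst_sum, Prod.smul_snd, Prod.smul_fst]
      funext l
      simp [Finset.sum_apply, Pi.single_apply]
    · simp [Prod.snd_sum]
  rw [h, map_sum]
  refine Finset.sum_congr rfl fun i _ => ?_
  rw [map_smul, input_eq_fderiv, smul_eq_mul, mul_comm]

theorem internalHessian_apply (f : Family k) (t l : ℝ) :
    f.internalHessian (t, 0, l) = f.quadratic * t + f.mixed * l := by
  have h : ((t, 0, l) : Args k) = t • ((1, 0, 0) : Args k) + l • ((0, 0, 1) : Args k) := by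
    simp
  simp only [internalHessian, quadratic, mixed]
  rw [h, map_add, map_smul, map_smul]
  simp [mul_comm]

theorem isLittleO_sub_input (f : Family k) :
    (fun z : Args k => f.toFun z - f.toFun (z.1, 0, z.2.2) - ∑ i, f.input i * z.2.1 i)
      =o[𝓝 0] fun z => ‖z.2.1‖ := by
  have h : HasStrictFDerivAt f.toFun (fderiv ℝ f.toFun 0) 0 :=
    f.smooth.contDiffAt.hasStrictFDerivAt (by simp)
  have ht : Tendsto (fun z : Args k => (z, ((z.1, 0, z.2.2) : Args k))) (𝓝 0) (𝓝 (0, 0)) := by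
    have : Continuous fun z : Args k => (z, ((z.1, 0, z.2.2) : Args k)) := by fun_prop
    exact this.tendsto' _ _ (by simp)
  have h2 := (h.isLittleO.comp_tendsto ht).norm_right
  refine (h2.congr_left fun z => ?_).congr_right fun z => ?_
  · simp only [Function.comp_apply]
    rw [← fderiv_input_direction]
    congr 2
    simp [Prod.ext_iff]
  · simp [Prod.norm_def, sub_eq_add_neg]

theorem hasDerivAt_internal (f : Family k) (y : Fin k → ℝ) (l t : ℝ) :
    HasDerivAt (fun t : ℝ => f.toFun (t, y, l)) (f.internalDeriv (t, y, l)) t := by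
  have h1 : HasDerivAt (fun t : ℝ => ((t, y, l) : Args k)) (1, 0, 0) t :=
    (hasDerivAt_id t).prodMk (hasDerivAt_const t _)
  exact (f.differentiable (t, y, l)).hasFDerivAt.comp_hasDerivAt t h1

theorem internalDeriv_zero {f : Family k} (hf : f.internal = 0) : f.internalDeriv 0 = 0 := by
  rw [← hf, internal_eq_fderiv]; rfl

theorem isLittleO_internal {f : Family k} (hf : f.internal = 0) :
    (fun z : Args k => f.toFun (z.1, 0, z.2.2) -
      (f.quadratic / 2 * z.1 ^ 2 + f.mixed * (z.1 * z.2.2)))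
      =o[𝓝 0] fun z => |z.1| * (|z.1| + |z.2.2|) := by
  rw [isLittleO_iff]
  intro ε hε
  have h := (f.internalDeriv_differentiable 0).hasFDerivAt.isLittleO
  rw [isLittleO_iff] at h
  obtain ⟨δ, hδ, hb⟩ := Metric.eventually_nhds_iff.1 (h hε)
  filter_upwards [Metric.ball_mem_nhds (0 : Args k) hδ] with z hz
  have hz1 : ‖z‖ < δ := by simpa using hz
  have hzx : |z.1| ≤ ‖z‖ := norm_fst_le z
  have hzl : |z.2.2| ≤ ‖z‖ := (norm_snd_le z.2).trans (norm_snd_le z)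
  set φ : ℝ → ℝ := fun t => f.toFun (t, 0, z.2.2) -
      (f.quadratic / 2 * t ^ 2 + f.mixed * (t * z.2.2)) with hφ
  have hφ' : ∀ t, HasDerivAt φ (f.internalDeriv (t, 0, z.2.2) -
      f.internalHessian (t, 0, z.2.2)) t := by
    intro t
    rw [internalHessian_apply]
    refine (f.hasDerivAt_internal 0 z.2.2 t).sub ?_
    refine (((hasDerivAt_pow 2 t).const_mul (f.quadratic / 2)).add
      (((hasDerivAt_id t).mul_const z.2.2).const_mul f.mixed)).congr_deriv ?_
    simp; ring
  have hmem : ∀ t ∈ Metric.closedBall (0 : ℝ) |z.1|,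
      ‖f.internalDeriv (t, 0, z.2.2) - f.internalHessian (t, 0, z.2.2)‖ ≤
        ε * (|z.1| + |z.2.2|) := by
    intro t ht
    have ht' : |t| ≤ |z.1| := by simpa using ht
    have hn : ‖((t, 0, z.2.2) : Args k)‖ ≤ max |t| |z.2.2| := by
      simp [Prod.norm_def]
    have hd : dist ((t, 0, z.2.2) : Args k) 0 < δ := by
      rw [dist_zero_right]
      exact hn.trans_lt (max_lt (by linarith) (by linarith))
    have := hb hd
    rw [internalDeriv_zero hf] at this
    simp only [sub_zero] at this
    refine this.trans (mul_le_mul_of_nonneg_left (hn.trans ?_) hε.le)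
    exact max_le (by linarith [abs_nonneg z.2.2]) (by linarith [abs_nonneg z.1])
  have := (convex_closedBall (0 : ℝ) |z.1|).norm_image_sub_le_of_norm_hasDerivWithin_le
    (fun t _ => (hφ' t).hasDerivWithinAt) hmem (x := 0) (y := z.1) (by simp) (by simp)
  have h0 : φ 0 = 0 := by simp [hφ, f.zero_eq]
  rw [h0, sub_zero, sub_zero] at this
  have hnn : 0 ≤ |z.1| * (|z.1| + |z.2.2|) := by positivity
  rw [Real.norm_of_nonneg hnn]
  calc _ ≤ ε * (|z.1| + |z.2.2|) * |z.1| := this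
    _ = _ := by ring

theorem exists_expansion {f : Family k} (hf : f.internal = 0) :
    ∃ r : Args k → ℝ, Tendsto r (𝓝 0) (𝓝 0) ∧ ∀ᶠ z in 𝓝 (0 : Args k),
      f.toFun z = ∑ i, f.input i * z.2.1 i + f.quadratic / 2 * z.1 ^ 2 + f.mixed * (z.1 * z.2.2) +
        r z * (‖z.2.1‖ + |z.1| * (|z.1| + |z.2.2|)) := by
  have h1 : (fun z : Args k => ‖z.2.1‖) =O[𝓝 0]
      fun z => ‖z.2.1‖ + |z.1| * (|z.1| + |z.2.2|) :=
    IsBigO.of_norm_le fun z => by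
      rw [norm_norm]; exact le_add_of_nonneg_right (by positivity)
  have h2 : (fun z : Args k => |z.1| * (|z.1| + |z.2.2|)) =O[𝓝 0]
      fun z => ‖z.2.1‖ + |z.1| * (|z.1| + |z.2.2|) :=
    IsBigO.of_norm_le fun z => by
      rw [Real.norm_of_nonneg (by positivity)]; exact le_add_of_nonneg_left (by positivity)
  have h := (f.isLittleO_sub_input.trans_isBigO h1).add ((isLittleO_internal hf).trans_isBigO h2)
  obtain ⟨r, hr, he⟩ := h.exists_eq_mul
  refine ⟨r, hr, he.mono fun z hz => ?_⟩
  simp only [Pi.mul_apply] at hz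
  linarith

theorem exists_internalDeriv_eq_zero (f : Family k) {s t l : ℝ} {y : Fin k → ℝ} (hne : s ≠ t)
    (h : f.toFun (s, y, l) = f.toFun (t, y, l)) :
    ∃ ξ ∈ Set.uIcc s t, f.internalDeriv (ξ, y, l) = 0 := by
  wlog hst : s < t generalizing s t
  · rw [Set.uIcc_comm]
    exact this hne.symm h.symm (lt_of_le_of_ne (not_lt.1 hst) hne.symm)
  obtain ⟨ξ, hξ, h0⟩ := exists_hasDerivAt_eq_zero hst
    (fun u _ => (f.hasDerivAt_internal y l u).continuousAt.continuousWithinAt) h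
    fun u _ => f.hasDerivAt_internal y l u
  exact ⟨ξ, Set.Icc_subset_uIcc (Set.Ioo_subset_Icc_self hξ), h0⟩

/-! ## Asymptotics of solutions of the equilibrium equation of a single cell -/

section Asymptotics

variable {α : Type*} {F : Filter α} {f : Family k} {x lam ρ : α → ℝ} {y : α → Fin k → ℝ}

theorem tendsto_args {s l : ℝ} {Y : Fin k → ℝ} (hx : Tendsto x F (𝓝 s))
    (hy : Tendsto y F (𝓝 Y)) (hl : Tendsto lam F (𝓝 l)) :
    Tendsto (fun n => ((x n, y n, lam n) : Args k)) F (𝓝 (s, Y, l)) :=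
  hx.prodMk_nhds (hy.prodMk_nhds hl)

/-- A solution whose inputs are of order `ρ` has order `√ρ`. -/
theorem tendsto_sq_div (hf : f.internal = 0) (hq : f.quadratic ≠ 0)
    (hx : Tendsto x F (𝓝 0)) (hlam : Tendsto lam F (𝓝 0)) (hρ : ∀ᶠ n in F, 0 < ρ n)
    (hρ0 : Tendsto ρ F (𝓝 0)) {l : ℝ} (hl : Tendsto (fun n => lam n / ρ n) F (𝓝 l))
    {Y : Fin k → ℝ} (hy : ∀ i, Tendsto (fun n => y n i / ρ n) F (𝓝 (Y i)))
    (heq : ∀ᶠ n in F, f.toFun (x n, y n, lam n) = 0) :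
    Tendsto (fun n => x n ^ 2 / ρ n) F (𝓝 (-2 / f.quadratic * ∑ i, f.input i * Y i)) := by
  obtain ⟨r, hr, hexp⟩ := exists_expansion hf
  have hyρ : Tendsto (fun n => (ρ n)⁻¹ • y n) F (𝓝 Y) := by
    refine tendsto_pi_nhds.2 fun i => (hy i).congr fun n => ?_
    simp [div_eq_inv_mul]
  have hy0 : Tendsto y F (𝓝 0) := by
    refine tendsto_pi_nhds.2 fun i => ?_
    have : Tendsto (fun n => y n i / ρ n * ρ n) F (𝓝 (Y i * 0)) := (hy i).mul hρ0
    rw [mul_zero] at this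
    refine this.congr' (hρ.mono fun n hn => ?_)
    field_simp
  have hz := tendsto_args hx hy0 hlam
  have hr' := hr.comp hz
  have hden : Tendsto (fun n => f.quadratic / 2 + r (x n, y n, lam n)) F
      (𝓝 (f.quadratic / 2 + 0)) := tendsto_const_nhds.add hr'
  have hS : Tendsto (fun n => ∑ i, f.input i * (y n i / ρ n)) F (𝓝 (∑ i, f.input i * Y i)) :=
    tendsto_finsetSum _ fun i _ => tendsto_const_nhds.mul (hy i)
  have hnum : Tendsto (fun n => -(∑ i, f.input i * (y n i / ρ n) +
      f.mixed * (x n * (lam n / ρ n)) +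
      r (x n, y n, lam n) * (‖(ρ n)⁻¹ • y n‖ + |x n| * |lam n / ρ n|))) F
      (𝓝 (-(∑ i, f.input i * Y i + f.mixed * (0 * l) + 0 * (‖Y‖ + |0| * |l|)))) :=
    ((hS.add ((hx.mul hl).const_mul _)).add (hr'.mul (hyρ.norm.add (hx.abs.mul hl.abs)))).neg
  have hq2 : f.quadratic / 2 + 0 ≠ 0 := by simpa using hq
  have h := hnum.div hden hq2
  have e : -(∑ i, f.input i * Y i + f.mixed * (0 * l) + 0 * (‖Y‖ + |0| * |l|)) /
      (f.quadratic / 2 + 0) = -2 / f.quadratic * ∑ i, f.input i * Y i := by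
    simp only [add_zero, zero_mul, mul_zero]
    field_simp
  rw [e] at h
  refine h.congr' ?_
  filter_upwards [hρ, heq, hz.eventually hexp, hden.eventually_ne hq2] with n hn h0 h1 h2
  rw [h0] at h1
  simp only [Pi.div_apply] at *
  rw [div_eq_iff h2]
  have e1 : ∑ i, f.input i * (y n i / ρ n) = (∑ i, f.input i * y n i) / ρ n := by
    rw [Finset.sum_div]; exact Finset.sum_congr rfl fun i _ => by ring
  have e2 : ‖(ρ n)⁻¹ • y n‖ = ‖y n‖ / ρ n := by
    rw [norm_smul, norm_inv, Real.norm_of_nonneg hn.le, div_eq_inv_mul]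
  have e3 : |lam n / ρ n| = |lam n| / ρ n := by rw [abs_div, abs_of_pos hn]
  rw [e1, e2, e3]
  field_simp
  have h3 : |x n| * |x n| = x n ^ 2 := by rw [← sq, sq_abs]
  linear_combination 2 * h1 + 2 * r (x n, y n, lam n) * h3

/-- A non-zero solution with vanishing inputs is of order `λ`. -/
theorem tendsto_div_lam (hf : f.internal = 0) (hq : f.quadratic ≠ 0)
    (hx : Tendsto x F (𝓝 0)) (hlam : Tendsto lam F (𝓝 0)) (hlam0 : ∀ᶠ n in F, lam n ≠ 0)
    (hx0 : ∀ᶠ n in F, x n ≠ 0) (hy : ∀ᶠ n in F, y n = 0)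
    (heq : ∀ᶠ n in F, f.toFun (x n, y n, lam n) = 0) :
    Tendsto (fun n => x n / lam n) F (𝓝 (-2 * f.mixed / f.quadratic)) := by
  obtain ⟨r, hr, hexp⟩ := exists_expansion hf
  have hy0 : Tendsto y F (𝓝 0) := tendsto_const_nhds.congr' (hy.mono fun n h => h.symm)
  have hz := tendsto_args hx hy0 hlam
  have hr' := hr.comp hz
  have hden : Tendsto (fun n => f.quadratic / 2 + r (x n, y n, lam n)) F
      (𝓝 (f.quadratic / 2 + 0)) := tendsto_const_nhds.add hr'
  have hs : Tendsto (fun n => r (x n, y n, lam n) * (|x n| / x n * (|lam n| / lam n))) F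
      (𝓝 0) := by
    refine squeeze_zero_norm (fun n => ?_) (by simpa using hr'.norm)
    have h1 : ∀ t : ℝ, |(|t| / t)| ≤ 1 := fun t => by
      rw [abs_div, abs_abs]; exact div_self_le_one _
    rw [norm_mul, norm_mul]
    refine mul_le_of_le_one_right (norm_nonneg _) (mul_le_one₀ (h1 _) (norm_nonneg _) (h1 _))
  have hnum := (tendsto_const_nhds (x := f.mixed) (f := F)).add hs |>.neg
  have hq2 : f.quadratic / 2 + 0 ≠ 0 := by simpa using hq
  have h := hnum.div hden hq2
  have e : -(f.mixed + 0) / (f.quadratic / 2 + 0) = -2 * f.mixed / f.quadratic := by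
    simp only [add_zero]
    field_simp
  rw [e] at h
  refine h.congr' ?_
  filter_upwards [hlam0, hx0, hy, heq, hz.eventually hexp, hden.eventually_ne hq2]
    with n hl hxn hyn h0 h1 h2
  rw [h0] at h1
  simp only [Pi.div_apply] at *
  rw [div_eq_iff h2]
  generalize r (x n, y n, lam n) = R at *
  rw [hyn] at h1
  simp only [Pi.zero_apply, mul_zero, Finset.sum_const_zero, norm_zero, zero_add] at h1
  have h3 : |x n| * |x n| = x n ^ 2 := by rw [← sq, sq_abs]
  have h4 : |lam n| * |lam n| = lam n ^ 2 := by rw [← sq, sq_abs]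
  field_simp
  linear_combination 2 * h1 + 2 * R * h3

/-- Two distinct solutions with the same inputs cannot have the same leading coefficient, unless
this coefficient is a critical point of the leading part. -/
theorem critical_of_tendsto_same [F.NeBot] (hf : f.internal = 0) {x' : α → ℝ}
    (hρ : ∀ᶠ n in F, ρ n ≠ 0) (hρ0 : Tendsto ρ F (𝓝 0)) {l : ℝ}
    (hl : Tendsto (fun n => lam n / ρ n) F (𝓝 l))
    (hy : ∀ i, Tendsto (fun n => y n i / ρ n) F (𝓝 0)) {s : ℝ}
    (hx : Tendsto (fun n => x n / ρ n) F (𝓝 s)) (hx' : Tendsto (fun n => x' n / ρ n) F (𝓝 s))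
    (hne : ∀ᶠ n in F, x n ≠ x' n)
    (heq : ∀ᶠ n in F, f.toFun (x n, y n, lam n) = f.toFun (x' n, y n, lam n)) :
    f.quadratic * s + f.mixed * l = 0 := by
  have hex : ∀ n, ∃ ξ, x n ≠ x' n → f.toFun (x n, y n, lam n) = f.toFun (x' n, y n, lam n) →
      ξ ∈ Set.uIcc (x n) (x' n) ∧ f.internalDeriv (ξ, y n, lam n) = 0 := fun n => by
    by_cases h1 : x n ≠ x' n
    · by_cases h2 : f.toFun (x n, y n, lam n) = f.toFun (x' n, y n, lam n)
      · obtain ⟨ξ, h⟩ := f.exists_internalDeriv_eq_zero h1 h2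
        exact ⟨ξ, fun _ _ => h⟩
      · exact ⟨0, fun _ h => (h2 h).elim⟩
    · exact ⟨0, fun h => (h1 h).elim⟩
  choose ξ hξ using hex
  have hξ' : ∀ᶠ n in F, ξ n ∈ Set.uIcc (x n) (x' n) ∧ f.internalDeriv (ξ n, y n, lam n) = 0 := by
    filter_upwards [hne, heq] with n h1 h2 using hξ n h1 h2
  have hξs : Tendsto (fun n => ξ n / ρ n) F (𝓝 s) := by
    have h0 : Tendsto (fun n => |x n / ρ n - s| + |x' n / ρ n - s|) F (𝓝 0) := by
      simpa using (hx.sub_const s).abs.add (hx'.sub_const s).abs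
    rw [tendsto_iff_norm_sub_tendsto_zero]
    refine squeeze_zero' (Eventually.of_forall fun _ => norm_nonneg _) ?_ h0
    filter_upwards [hξ', hρ] with n hn hρn
    have hmem : ξ n / ρ n ∈ Set.uIcc (x n / ρ n) (x' n / ρ n) := by
      have := Set.mem_image_of_mem (fun t => t / ρ n) hn.1
      rwa [Set.image_div_const_uIcc] at this
    rw [Real.norm_eq_abs]
    have h1 := neg_abs_le (x n / ρ n - s)
    have h2 := le_abs_self (x n / ρ n - s)
    have h3 := neg_abs_le (x' n / ρ n - s)
    have h4 := le_abs_self (x' n / ρ n - s)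
    have h5 := abs_nonneg (x n / ρ n - s)
    have h6 := abs_nonneg (x' n / ρ n - s)
    rcases Set.mem_uIcc.1 hmem with h | h <;> rw [abs_le] <;> constructor <;> linarith [h.1, h.2]
  have hv : Tendsto (fun n => (ρ n)⁻¹ • ((ξ n, y n, lam n) : Args k)) F (𝓝 (s, 0, l)) := by
    have hy' : Tendsto (fun n => (ρ n)⁻¹ • y n) F (𝓝 0) :=
      tendsto_pi_nhds.2 fun i => (hy i).congr fun n => by simp [div_eq_inv_mul]
    refine (tendsto_args hξs hy' hl).congr fun n => ?_
    simp [div_eq_inv_mul]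
  have hd : Tendsto (fun n => ((ξ n, y n, lam n) : Args k)) F (𝓝 0) := by
    have h := hρ0.smul hv
    rw [zero_smul] at h
    exact h.congr' (hρ.mono fun n hn => smul_inv_smul₀ hn _)
  have hlim := (f.internalDeriv_differentiable 0).hasFDerivAt.hasFDerivWithinAt.lim hd
    (Eventually.of_forall fun _ => Set.mem_univ _) hv
  have hz : Tendsto (fun n => (ρ n)⁻¹ • (f.internalDeriv (0 + ((ξ n, y n, lam n) : Args k)) -
      f.internalDeriv 0)) F (𝓝 0) := by
    refine tendsto_const_nhds.congr' (hξ'.mono fun n hn => ?_)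
    simp only [zero_add, hn.2, internalDeriv_zero hf, sub_zero, smul_zero]
  rw [← internalHessian_apply]
  exact tendsto_nhds_unique hlim hz

end Asymptotics

end Family

end FeedForward

end

noncomputable section

namespace FeedForward

open Filter

/-! ## Asymptotics of equilibria of feed-forward networks -/

section Scale

/-- The orders of magnitude `λ ^ (1 / 2 ^ p)`, with normalizing constants. -/
def scale (A κ : ℝ) : ℕ → ℝ → ℝ
  | 0, l => A * |l|
  | p + 1, l => √(κ * scale A κ p l)

variable {A κ : ℝ}

theorem scale_pos (hA : 0 < A) (hκ : 0 < κ) (p : ℕ) {l : ℝ} (hl : l ≠ 0) : 0 < scale A κ p l := by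
  induction p with
  | zero => exact mul_pos hA (abs_pos.2 hl)
  | succ p ih => exact Real.sqrt_pos.2 (mul_pos hκ ih)

theorem scale_zero_right (p : ℕ) : scale A κ p 0 = 0 := by
  induction p with
  | zero => simp [scale]
  | succ p ih => simp [scale, ih]

theorem continuous_scale (p : ℕ) : Continuous (scale A κ p) := by
  induction p with
  | zero => exact continuous_const.mul continuous_abs
  | succ p ih => exact (continuous_const.mul ih).sqrt

variable {α : Type*} {F : Filter α} {lam : α → ℝ}

theorem tendsto_scale (hlam : Tendsto lam F (𝓝 0)) (p : ℕ) :
    Tendsto (fun n => scale A κ p (lam n)) F (𝓝 0) := by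
  have h := ((continuous_scale (A := A) (κ := κ) p).tendsto 0).comp hlam
  rwa [scale_zero_right] at h

theorem tendsto_scale_div_succ (hA : 0 < A) (hκ : 0 < κ) (hlam : Tendsto lam F (𝓝 0))
    (hlam0 : ∀ᶠ n in F, lam n ≠ 0) (p : ℕ) :
    Tendsto (fun n => scale A κ p (lam n) / scale A κ (p + 1) (lam n)) F (𝓝 0) := by
  have h := (tendsto_scale (A := A) (κ := κ) hlam (p + 1)).div_const κ
  rw [zero_div] at h
  refine h.congr' (hlam0.mono fun n hn => ?_)
  have h1 := scale_pos hA hκ (p + 1) hn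
  have h2 : scale A κ (p + 1) (lam n) ^ 2 = κ * scale A κ p (lam n) :=
    Real.sq_sqrt (mul_pos hκ (scale_pos hA hκ p hn)).le
  rw [div_eq_div_iff hκ.ne' h1.ne']
  linarith

theorem tendsto_scale_div (hA : 0 < A) (hκ : 0 < κ) (hlam : Tendsto lam F (𝓝 0))
    (hlam0 : ∀ᶠ n in F, lam n ≠ 0) {p q : ℕ} (hpq : p < q) :
    Tendsto (fun n => scale A κ p (lam n) / scale A κ q (lam n)) F (𝓝 0) := by
  induction q, hpq using Nat.le_induction with
  | base => exact tendsto_scale_div_succ hA hκ hlam hlam0 p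
  | succ q _ ih =>
    have h := ih.mul (tendsto_scale_div_succ hA hκ hlam hlam0 q)
    rw [zero_mul] at h
    refine h.congr' (hlam0.mono fun n hn => ?_)
    exact div_mul_div_cancel₀ (scale_pos hA hκ q hn).ne'

end Scale

section Ultrafilter

variable {α : Type*} {F : Ultrafilter α}

theorem tendsto_sqrt_or_neg {w : α → ℝ} {E : ℝ} (h : Tendsto (fun n => w n ^ 2) F (𝓝 E)) :
    Tendsto w F (𝓝 √E) ∨ Tendsto w F (𝓝 (-√E)) := by
  have h1 : Tendsto (fun n => |w n|) F (𝓝 √E) := by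
    simpa only [Real.sqrt_sq_eq_abs] using h.sqrt
  rcases F.eventually_or.1 (Eventually.of_forall fun n => le_total 0 (w n)) with h0 | h0
  · exact Or.inl (h1.congr' (h0.mono fun n hn => abs_of_nonneg hn))
  · exact Or.inr (h1.neg.congr' (h0.mono fun n hn => by rw [abs_of_nonpos hn, neg_neg]))

/-- Along an ultrafilter, the parameter is asymptotically a multiple of each scale. -/
theorem exists_tendsto_lam_div_scale {A κ : ℝ} (hA : 0 < A) (hκ : 0 < κ) {lam : α → ℝ}
    (hlam : Tendsto lam F (𝓝 0)) (hlam0 : ∀ᶠ n in F, lam n ≠ 0) :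
    ∃ s : ℝ, (s = 1 ∨ s = -1) ∧ Tendsto (fun n => lam n / scale A κ 0 (lam n)) F (𝓝 (s / A)) ∧
      ∀ p, Tendsto (fun n => lam n / scale A κ (p + 1) (lam n)) F (𝓝 0) := by
  have hkey : ∃ s : ℝ, (s = 1 ∨ s = -1) ∧ ∀ᶠ n in F, lam n / scale A κ 0 (lam n) = s / A := by
    rcases F.eventually_or.1 (hlam0.mono fun n hn => hn.lt_or_gt) with h | h
    · refine ⟨-1, Or.inr rfl, h.mono fun n hn => ?_⟩
      have := hn.ne
      rw [scale, abs_of_neg hn]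
      field_simp
    · refine ⟨1, Or.inl rfl, h.mono fun n hn => ?_⟩
      rw [scale, abs_of_pos hn]
      field_simp
  obtain ⟨s, hs, he⟩ := hkey
  have h0 : Tendsto (fun n => lam n / scale A κ 0 (lam n)) F (𝓝 (s / A)) :=
    tendsto_const_nhds.congr' (he.mono fun n hn => hn.symm)
  refine ⟨s, hs, h0, fun p => ?_⟩
  have h := h0.mul (tendsto_scale_div hA hκ hlam hlam0 (Nat.succ_pos p))
  rw [mul_zero] at h
  refine h.congr' (hlam0.mono fun n hn => ?_)
  exact div_mul_div_cancel₀ (scale_pos hA hκ 0 hn).ne'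

end Ultrafilter

/-- Equilibria `x` at parameters `lam` that converge to the origin along an ultrafilter, at
non-zero parameters. -/
structure EquilibriaAlong {k : ℕ} {C α : Type*} (f : Family k) (N : Network k C)
    (F : Ultrafilter α) (lam : α → ℝ) (x : α → C → ℝ) : Prop where
  lam_ne : ∀ᶠ n in F, lam n ≠ 0
  lam_tendsto : Tendsto lam F (𝓝 0)
  tendsto : ∀ a, Tendsto (fun n => x n a) F (𝓝 0)
  eq_zero : ∀ a, ∀ᶠ n in F, f.toFun (x n a, fun i => x n (N.σ i a), lam n) = 0

/-- The slope `-2 f_0λ / f_00` of the non-trivial branch of a single cell. -/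
def Family.slope {k : ℕ} (f : Family k) : ℝ := -2 * f.mixed / f.quadratic

/-- The scales adapted to a family. -/
def Family.scale {k : ℕ} (f : Family k) : ℕ → ℝ → ℝ :=
  FeedForward.scale |f.slope| |-2 / f.quadratic|

namespace Family.NonDegenerate

variable {k m : ℕ} {f : Family k}

theorem slope_ne (hf : f.NonDegenerate m) : f.slope ≠ 0 :=
  div_ne_zero (mul_ne_zero (by norm_num) hf.mixed_ne) hf.quadratic_ne

theorem abs_slope_pos (hf : f.NonDegenerate m) : 0 < |f.slope| := abs_pos.2 hf.slope_ne

theorem coeff_ne (hf : f.NonDegenerate m) : -2 / f.quadratic ≠ 0 :=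
  div_ne_zero (by norm_num) hf.quadratic_ne

theorem abs_coeff_pos (hf : f.NonDegenerate m) : 0 < |-2 / f.quadratic| := abs_pos.2 hf.coeff_ne

theorem scale_pos (hf : f.NonDegenerate m) (p : ℕ) {l : ℝ} (hl : l ≠ 0) : 0 < f.scale p l :=
  FeedForward.scale_pos hf.abs_slope_pos hf.abs_coeff_pos p hl

end Family.NonDegenerate

/-- The leading behaviour of a cell: identically zero, or of the order of some scale `p < l`. -/
def HasLeadingCoeff {k : ℕ} {α : Type*} (f : Family k) (F : Ultrafilter α) (lam z : α → ℝ)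
    (l : ℕ) : Prop :=
  (∀ᶠ n in F, z n = 0) ∨ ∃ p < l, ∃ t ∈ leadingCoeffs k p,
    Tendsto (fun n => z n / f.scale p (lam n)) F (𝓝 (t f.input))

section Step

variable {k m l : ℕ} {α : Type*} {f : Family k} {F : Ultrafilter α} {lam : α → ℝ}
  {y : α → Fin k → ℝ} {z : α → ℝ}

theorem inputs_zero_or_order (hf : f.NonDegenerate m) (hlam : Tendsto lam F (𝓝 0))
    (hlam0 : ∀ᶠ n in F, lam n ≠ 0)
    (hy : ∀ i, HasLeadingCoeff f F lam (fun n => y n i) l) :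
    (∀ᶠ n in F, y n = 0) ∨ ∃ p < l, ∃ e ∈ inputSums (leadingCoeffs k p), ∃ Y : Fin k → ℝ,
      (∀ i, Tendsto (fun n => y n i / f.scale p (lam n)) F (𝓝 (Y i))) ∧
      ∑ i, f.input i * Y i = e f.input := by
  classical
  let P : Fin k → ℕ → Prop := fun i p => ∃ t ∈ leadingCoeffs k p,
    Tendsto (fun n => y n i / f.scale p (lam n)) F (𝓝 (t f.input))
  by_cases hS : ((Finset.range l).filter fun p => ∃ i, P i p).Nonempty
  · right
    obtain ⟨p, hp, hmax⟩ := Finset.exists_max_image _ id hS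
    simp only [Finset.mem_filter, Finset.mem_range] at hp hmax
    obtain ⟨hpl, i₀, hi₀⟩ := hp
    have hc : ∀ i, ∃ c : (Fin k → ℝ) → ℝ, (c = 0 ∨ c ∈ leadingCoeffs k p) ∧
        (P i p → c ∈ leadingCoeffs k p) ∧
        Tendsto (fun n => y n i / f.scale p (lam n)) F (𝓝 (c f.input)) := by
      intro i
      by_cases hi : P i p
      · obtain ⟨t, ht, hlim⟩ := hi
        exact ⟨t, Or.inr ht, fun _ => ht, hlim⟩
      · refine ⟨0, Or.inl rfl, fun h => (hi h).elim, ?_⟩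
        rcases hy i with h0 | ⟨q, hq, t, ht, hlim⟩
        · refine tendsto_const_nhds.congr' (h0.mono fun n hn => ?_)
          change (0 : ℝ) = y n i / _
          rw [show y n i = 0 from hn, zero_div]
        · have hqp : q < p := by
            refine lt_of_le_of_ne (hmax q ⟨hq, i, t, ht, hlim⟩) ?_
            rintro rfl
            exact hi ⟨t, ht, hlim⟩
          have h := hlim.mul (tendsto_scale_div hf.abs_slope_pos hf.abs_coeff_pos hlam hlam0 hqp)
          rw [mul_zero] at h
          refine h.congr' (hlam0.mono fun n hn => ?_)
          exact div_mul_div_cancel₀ (hf.scale_pos q hn).ne'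
    choose c hc1 hc2 hc3 using hc
    exact ⟨p, hpl, _, ⟨c, hc1, ⟨i₀, hc2 i₀ hi₀⟩, rfl⟩, fun i => c i f.input, hc3, rfl⟩
  · left
    have h0 : ∀ i, ∀ᶠ n in F, y n i = 0 := by
      intro i
      rcases hy i with h0 | ⟨q, hq, h⟩
      · exact h0
      · exact (hS ⟨q, by simpa using ⟨hq, i, h⟩⟩).elim
    exact (eventually_all.2 h0).mono fun n hn => funext hn

/-- A cell with vanishing inputs vanishes or follows the non-trivial branch of a single cell. -/
theorem zero_or_slope (hf : f.NonDegenerate m) (hlam : Tendsto lam F (𝓝 0))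
    (hlam0 : ∀ᶠ n in F, lam n ≠ 0) (hz : Tendsto z F (𝓝 0)) (hy : ∀ᶠ n in F, y n = 0)
    (heq : ∀ᶠ n in F, f.toFun (z n, y n, lam n) = 0) :
    (∀ᶠ n in F, z n = 0) ∨ Tendsto (fun n => z n / lam n) F (𝓝 f.slope) := by
  rcases F.em fun n => z n = 0 with h | h
  · exact Or.inl h
  · exact Or.inr (Family.tendsto_div_lam hf.internal hf.quadratic_ne hz hlam hlam0 h hy heq)

theorem tendsto_div_scale_zero (hf : f.NonDegenerate m) (hlam : Tendsto lam F (𝓝 0))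
    (hlam0 : ∀ᶠ n in F, lam n ≠ 0) (hz : Tendsto (fun n => z n / lam n) F (𝓝 f.slope)) :
    ∃ s : ℝ, (s = 1 ∨ s = -1) ∧ Tendsto (fun n => z n / f.scale 0 (lam n)) F (𝓝 s) := by
  obtain ⟨s, hs, h, -⟩ := exists_tendsto_lam_div_scale hf.abs_slope_pos hf.abs_coeff_pos hlam hlam0
  refine ⟨f.slope * (s / |f.slope|), ?_, (hz.mul h).congr' (hlam0.mono fun n hn => ?_)⟩
  · have := hf.slope_ne
    rcases abs_choice f.slope with hs' | hs' <;> rcases hs with rfl | rfl <;> rw [hs'] <;> field_simp <;>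
      simp
  · exact div_mul_div_cancel₀ hn

/-- A cell whose inputs are of the order of scale `p` is of the order of scale `p + 1`. -/
theorem tendsto_div_scale_succ (hf : f.NonDegenerate m) (hlam : Tendsto lam F (𝓝 0))
    (hlam0 : ∀ᶠ n in F, lam n ≠ 0) (hz : Tendsto z F (𝓝 0))
    (heq : ∀ᶠ n in F, f.toFun (z n, y n, lam n) = 0) {p : ℕ} {Y : Fin k → ℝ}
    (hY : ∀ i, Tendsto (fun n => y n i / f.scale p (lam n)) F (𝓝 (Y i))) :
    0 ≤ -2 / f.quadratic * ∑ i, f.input i * Y i ∧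
      (Tendsto (fun n => z n / f.scale (p + 1) (lam n)) F (𝓝 √|∑ i, f.input i * Y i|) ∨
        Tendsto (fun n => z n / f.scale (p + 1) (lam n)) F (𝓝 (-√|∑ i, f.input i * Y i|))) := by
  obtain ⟨s, -, hl0, hl1⟩ :=
    exists_tendsto_lam_div_scale hf.abs_slope_pos hf.abs_coeff_pos hlam hlam0
  obtain ⟨l, hl⟩ : ∃ l, Tendsto (fun n => lam n / f.scale p (lam n)) F (𝓝 l) := by
    cases p with
    | zero => exact ⟨_, hl0⟩
    | succ p => exact ⟨_, hl1 p⟩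
  have hpos : ∀ᶠ n in F, 0 < f.scale p (lam n) := hlam0.mono fun n hn => hf.scale_pos p hn
  have h := Family.tendsto_sq_div hf.internal hf.quadratic_ne hz hlam hpos
    (tendsto_scale hlam p) hl hY heq
  have hnn : 0 ≤ -2 / f.quadratic * ∑ i, f.input i * Y i :=
    ge_of_tendsto h (hpos.mono fun n hn => by positivity)
  refine ⟨hnn, tendsto_sqrt_or_neg ?_⟩
  have h' := h.div_const |-2 / f.quadratic|
  have e : -2 / f.quadratic * (∑ i, f.input i * Y i) / |-2 / f.quadratic| =
      |∑ i, f.input i * Y i| := by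
    rw [← abs_of_nonneg hnn, abs_mul, mul_div_cancel_left₀ _ hf.abs_coeff_pos.ne']
  rw [e] at h'
  refine h'.congr' (hlam0.mono fun n hn => ?_)
  have h2 : f.scale (p + 1) (lam n) ^ 2 = |-2 / f.quadratic| * f.scale p (lam n) :=
    Real.sq_sqrt (mul_pos hf.abs_coeff_pos (hf.scale_pos p hn)).le
  simp only [div_pow]
  rw [h2, div_div, mul_comm (f.scale p (lam n))]

theorem hasLeadingCoeff_succ (hf : f.NonDegenerate m) (hlam : Tendsto lam F (𝓝 0))
    (hlam0 : ∀ᶠ n in F, lam n ≠ 0) (hz : Tendsto z F (𝓝 0))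
    (heq : ∀ᶠ n in F, f.toFun (z n, y n, lam n) = 0)
    (hy : ∀ i, HasLeadingCoeff f F lam (fun n => y n i) l) :
    HasLeadingCoeff f F lam z (l + 1) := by
  rcases inputs_zero_or_order hf hlam hlam0 hy with h0 | ⟨p, hp, e, he, Y, hY, hsum⟩
  · rcases zero_or_slope hf hlam hlam0 hz h0 heq with h | h
    · exact Or.inl h
    · obtain ⟨s, hs, h⟩ := tendsto_div_scale_zero hf hlam hlam0 h
      refine Or.inr ⟨0, Nat.succ_pos l, fun _ => s, ?_, h⟩
      rcases hs with rfl | rfl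
      · exact Or.inl rfl
      · exact Or.inr rfl
  · have h := (tendsto_div_scale_succ hf hlam hlam0 hz heq hY).2
    rw [hsum] at h
    rcases h with h | h
    · exact Or.inr ⟨p + 1, Nat.succ_lt_succ hp, _, ⟨e, he, Or.inl rfl⟩, h⟩
    · exact Or.inr ⟨p + 1, Nat.succ_lt_succ hp, _, ⟨e, he, Or.inr rfl⟩, h⟩

/-- A cell all of whose inputs come from itself vanishes. -/
theorem eventually_eq_zero_of_self_inputs [Nonempty (Fin k)] (hf : f.NonDegenerate m)
    (hlam : Tendsto lam F (𝓝 0)) (hz : Tendsto z F (𝓝 0))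
    (heq : ∀ᶠ n in F, f.toFun (z n, fun _ => z n, lam n) = 0) : ∀ᶠ n in F, z n = 0 := by
  rcases F.em fun n => z n = 0 with h0 | h0
  · exact h0
  exfalso
  have hne : ∑ i, f.input i ≠ 0 := by
    refine hf.input_mem 0 (Nat.zero_le m) (fun a => ∑ i, a i)
      ⟨fun _ _ => 1, fun _ => Or.inr (Or.inl rfl), ⟨Classical.arbitrary _, Or.inl rfl⟩, ?_⟩
    funext a; simp
  obtain ⟨r, hr, hexp⟩ := Family.exists_expansion hf.internal
  have hargs := Family.tendsto_args hz (tendsto_pi_nhds.2 fun _ : Fin k => hz) hlam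
  have hr' := hr.comp hargs
  have hlim : Tendsto (fun n => f.quadratic / 2 * z n + f.mixed * lam n +
      r (z n, fun _ => z n, lam n) * (|z n| / z n * (1 + (|z n| + |lam n|)))) F (𝓝 0) := by
    have h1 := (hz.const_mul (f.quadratic / 2)).add (hlam.const_mul f.mixed)
    have h2 : Tendsto (fun n => r (z n, fun _ => z n, lam n) *
        (|z n| / z n * (1 + (|z n| + |lam n|)))) F (𝓝 0) := by
      have h3 := hr'.norm.mul ((hz.abs.add hlam.abs).const_add 1)
      refine squeeze_zero_norm (fun n => ?_) (by simpa using h3)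
      have h4 : |(|z n| / z n)| ≤ 1 := by rw [abs_div, abs_abs]; exact div_self_le_one _
      have h5 : 0 ≤ 1 + (|z n| + |lam n|) := by positivity
      rw [norm_mul, Real.norm_eq_abs (_ * _), abs_mul, abs_of_nonneg h5]
      exact mul_le_mul_of_nonneg_left (mul_le_of_le_one_left h5 h4) (norm_nonneg _)
    simpa using h1.add h2
  have hlim2 : Tendsto (fun n => f.quadratic / 2 * z n + f.mixed * lam n +
      r (z n, fun _ => z n, lam n) * (|z n| / z n * (1 + (|z n| + |lam n|)))) F
      (𝓝 (-∑ i, f.input i)) := by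
    refine tendsto_const_nhds.congr' ?_
    filter_upwards [h0, heq, hargs.eventually hexp] with n hn h1 h2
    rw [h1, ← Finset.sum_mul] at h2
    have h3 : ‖fun _ : Fin k => z n‖ = |z n| := pi_norm_const _
    rw [h3] at h2
    field_simp
    linear_combination 2 * h2
  have := tendsto_nhds_unique hlim hlim2
  exact hne (by linarith)

end Step

section Network

variable {k m : ℕ} {C α : Type*} {f : Family k} {F : Ultrafilter α} {lam : α → ℝ}
  {x : α → C → ℝ}

theorem EquilibriaAlong.hasLeadingCoeff [Nonempty (Fin k)] {L : FFN k C}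
    (hx : EquilibriaAlong f L.toNetwork F lam x) (hf : f.NonDegenerate m) (a : C) :
    HasLeadingCoeff f F lam (fun n => x n a) (L.layer a) := by
  obtain ⟨l, hl⟩ : ∃ l, L.layer a = l := ⟨_, rfl⟩
  rw [hl]
  induction l generalizing a with
  | zero =>
    refine Or.inl (eventually_eq_zero_of_self_inputs hf hx.lam_tendsto (hx.tendsto a) ?_)
    have h := hx.eq_zero a
    simpa only [L.σ_first _ a hl] using h
  | succ l ih =>
    exact hasLeadingCoeff_succ hf hx.lam_tendsto hx.lam_ne (hx.tendsto a) (hx.eq_zero a)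
      fun i => ih _ (L.σ_succ i a l hl)

/-- Two different solutions with common inputs have, at some scale, leading coefficients that are
opposite or of which exactly one vanishes. -/
theorem exists_leading_pair {l : ℕ} {y : α → Fin k → ℝ} {z₁ z₂ : α → ℝ}
    (hf : f.NonDegenerate m) (hl : l ≤ m) (hlam : Tendsto lam F (𝓝 0))
    (hlam0 : ∀ᶠ n in F, lam n ≠ 0)
    (hy : ∀ i, HasLeadingCoeff f F lam (fun n => y n i) l)
    (hz₁ : Tendsto z₁ F (𝓝 0)) (hz₂ : Tendsto z₂ F (𝓝 0))
    (h₁ : ∀ᶠ n in F, f.toFun (z₁ n, y n, lam n) = 0)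
    (h₂ : ∀ᶠ n in F, f.toFun (z₂ n, y n, lam n) = 0) (hne : ∀ᶠ n in F, z₁ n ≠ z₂ n) :
    ∃ p Y₁ Y₂, Tendsto (fun n => z₁ n / f.scale p (lam n)) F (𝓝 Y₁) ∧
      Tendsto (fun n => z₂ n / f.scale p (lam n)) F (𝓝 Y₂) ∧
      ((Y₁ = 0 ∧ Y₂ ≠ 0) ∨ (Y₁ ≠ 0 ∧ Y₂ = 0) ∨ (Y₁ ≠ 0 ∧ Y₂ = -Y₁)) := by
  have heq : ∀ᶠ n in F, f.toFun (z₁ n, y n, lam n) = f.toFun (z₂ n, y n, lam n) := by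
    filter_upwards [h₁, h₂] with n a b using a.trans b.symm
  have hzero : ∀ {z : α → ℝ} (p : ℕ), (∀ᶠ n in F, z n = 0) →
      Tendsto (fun n => z n / f.scale p (lam n)) F (𝓝 0) := fun p h =>
    tendsto_const_nhds.congr' (h.mono fun n hn => by simp only [hn, zero_div])
  have hunit : ∀ {s : ℝ}, s = 1 ∨ s = -1 → s ≠ 0 := by rintro s (rfl | rfl) <;> norm_num
  rcases inputs_zero_or_order hf hlam hlam0 hy with h0 | ⟨p, hp, e, he, Y, hY, hsum⟩
  · rcases zero_or_slope hf hlam hlam0 hz₁ h0 h₁ with hz1 | hz1 <;>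
      rcases zero_or_slope hf hlam hlam0 hz₂ h0 h₂ with hz2 | hz2
    · obtain ⟨n, h, ha, hb⟩ := (hne.and (hz1.and hz2)).exists
      exact (h (ha.trans hb.symm)).elim
    · obtain ⟨s, hs, h⟩ := tendsto_div_scale_zero hf hlam hlam0 hz2
      exact ⟨0, 0, s, hzero 0 hz1, h, Or.inl ⟨rfl, hunit hs⟩⟩
    · obtain ⟨s, hs, h⟩ := tendsto_div_scale_zero hf hlam hlam0 hz1
      exact ⟨0, s, 0, h, hzero 0 hz2, Or.inr (Or.inl ⟨hunit hs, rfl⟩)⟩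
    · have h1 : Tendsto (fun n => lam n / lam n) F (𝓝 1) :=
        tendsto_const_nhds.congr' (hlam0.mono fun n hn => (div_self hn).symm)
      have := Family.critical_of_tendsto_same hf.internal hlam0 hlam h1
        (fun i => tendsto_const_nhds.congr' (h0.mono fun n hn => by simp [hn])) hz1 hz2 hne heq
      have hq := hf.quadratic_ne
      rw [Family.slope] at this
      field_simp at this
      exact (hf.mixed_ne (by linarith)).elim
  · obtain ⟨-, hz1⟩ := tendsto_div_scale_succ hf hlam hlam0 hz₁ h₁ hY
    obtain ⟨-, hz2⟩ := tendsto_div_scale_succ hf hlam hlam0 hz₂ h₂ hY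
    rw [hsum] at hz1 hz2
    have hs : √|e f.input| ≠ 0 := by
      have := hf.input_mem p (by omega) e he
      positivity
    have hsame : ∀ {s}, s ≠ 0 → Tendsto (fun n => z₁ n / f.scale (p + 1) (lam n)) F (𝓝 s) →
        ¬ Tendsto (fun n => z₂ n / f.scale (p + 1) (lam n)) F (𝓝 s) := by
      intro s hs hz1 hz2
      obtain ⟨-, -, -, hl1⟩ :=
        exists_tendsto_lam_div_scale hf.abs_slope_pos hf.abs_coeff_pos hlam hlam0
      have hy0 : ∀ i, Tendsto (fun n => y n i / f.scale (p + 1) (lam n)) F (𝓝 0) := by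
        intro i
        have h := (hY i).mul
          (tendsto_scale_div_succ hf.abs_slope_pos hf.abs_coeff_pos hlam hlam0 p)
        rw [mul_zero] at h
        refine h.congr' (hlam0.mono fun n hn => ?_)
        exact div_mul_div_cancel₀ (hf.scale_pos p hn).ne'
      have := Family.critical_of_tendsto_same hf.internal
        (hlam0.mono fun n hn => (hf.scale_pos (p + 1) hn).ne') (tendsto_scale hlam (p + 1))
        (hl1 p) hy0 hz1 hz2 hne heq
      rw [mul_zero, add_zero] at this
      exact mul_ne_zero hf.quadratic_ne hs this
    rcases hz1 with hz1 | hz1 <;> rcases hz2 with hz2 | hz2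
    · exact (hsame hs hz1 hz2).elim
    · exact ⟨p + 1, _, _, hz1, hz2, Or.inr (Or.inr ⟨hs, rfl⟩)⟩
    · exact ⟨p + 1, _, _, hz1, hz2, Or.inr (Or.inr ⟨neg_ne_zero.2 hs, (neg_neg _).symm⟩)⟩
    · exact (hsame (neg_ne_zero.2 hs) hz1 hz2).elim

theorem sum_input_eq_weight (N : Network k C) {c₁ c₂ d : C} (hc : c₁ ≠ c₂)
    (hd : ∀ i, N.σ i d = c₁ ∨ N.σ i d = c₂) {Y : C → ℝ} :
    ∑ i, f.input i * Y (N.σ i d) = weight f N c₁ d * Y c₁ + weight f N c₂ d * Y c₂ := by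
  classical
  simp only [weight, Finset.sum_mul, Finset.sum_filter]
  rw [← Finset.sum_add_distrib]
  refine Finset.sum_congr rfl fun i _ => ?_
  rcases hd i with h | h
  · simp [h, hc]
  · simp [h, hc.symm]

theorem weighted_sums_neg {w₁ w₂ v₁ v₂ Y₁ Y₂ : ℝ} (h₁ : w₁ * v₁ < 0) (h₂ : w₂ * v₂ < 0)
    (h : w₁ * v₁ + w₂ * v₂ < w₁ * v₂ + v₁ * w₂)
    (hY : (Y₁ = 0 ∧ Y₂ ≠ 0) ∨ (Y₁ ≠ 0 ∧ Y₂ = 0) ∨ (Y₁ ≠ 0 ∧ Y₂ = -Y₁)) :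
    (w₁ * Y₁ + w₂ * Y₂) * (v₁ * Y₁ + v₂ * Y₂) < 0 := by
  rcases hY with ⟨rfl, hY⟩ | ⟨hY, rfl⟩ | ⟨hY, rfl⟩
  · nlinarith [mul_neg_of_neg_of_pos h₂ (pow_pos (abs_pos.2 hY) 2), sq_abs Y₂]
  · nlinarith [mul_neg_of_neg_of_pos h₁ (pow_pos (abs_pos.2 hY) 2), sq_abs Y₁]
  · have : (w₁ - w₂) * (v₁ - v₂) < 0 := by linarith
    have := mul_neg_of_neg_of_pos this (sq_pos_of_ne_zero hY)
    linarith

/-- Cells with the same inputs have the same state if two cells that they force jointly have input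
weights of suitable signs. -/
theorem EquilibriaAlong.eventually_eq [Nonempty (Fin k)] {L : FFN k C}
    (hx : EquilibriaAlong f L.toNetwork F lam x) (hf : f.NonDegenerate m) (hm : L.depth ≤ m)
    {c₁ c₂ d' d'' : C} (hc : ∀ i, L.σ i c₁ = L.σ i c₂) {j : ℕ} (hj : L.layer c₁ = j + 1)
    (hd' : ∀ i, L.σ i d' = c₁ ∨ L.σ i d' = c₂) (hd'' : ∀ i, L.σ i d'' = c₁ ∨ L.σ i d'' = c₂)
    (h₁ : weight f L.toNetwork c₁ d' * weight f L.toNetwork c₁ d'' < 0)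
    (h₂ : weight f L.toNetwork c₂ d' * weight f L.toNetwork c₂ d'' < 0)
    (h : weight f L.toNetwork c₁ d' * weight f L.toNetwork c₁ d'' +
        weight f L.toNetwork c₂ d' * weight f L.toNetwork c₂ d'' <
      weight f L.toNetwork c₁ d' * weight f L.toNetwork c₂ d'' +
        weight f L.toNetwork c₁ d'' * weight f L.toNetwork c₂ d') :
    ∀ᶠ n in F, x n c₁ = x n c₂ := by
  classical
  rcases F.em fun n => x n c₁ = x n c₂ with h0 | hne
  · exact h0
  exfalso
  have hcne : c₁ ≠ c₂ := by
    rintro rfl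
    obtain ⟨n, hn⟩ := hne.exists
    exact hn rfl
  have hy : ∀ i, HasLeadingCoeff f F lam (fun n => x n (L.σ i c₁)) j := fun i => by
    have := hx.hasLeadingCoeff hf (L.σ i c₁)
    rwa [L.σ_succ i c₁ j hj] at this
  have hjm : j ≤ m := by have := L.layer_le c₁; omega
  obtain ⟨p, Y₁, Y₂, hY₁, hY₂, hY⟩ := exists_leading_pair hf hjm hx.lam_tendsto hx.lam_ne hy
    (hx.tendsto c₁) (hx.tendsto c₂) (hx.eq_zero c₁)
    (by simpa only [hc] using hx.eq_zero c₂) hne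
  let Y : C → ℝ := fun a => if a = c₁ then Y₁ else Y₂
  have hYc₁ : Y c₁ = Y₁ := by simp [Y]
  have hYc₂ : Y c₂ = Y₂ := by simp [Y, hcne.symm]
  have hsign : ∀ d, (∀ i, L.σ i d = c₁ ∨ L.σ i d = c₂) →
      0 ≤ -2 / f.quadratic * (weight f L.toNetwork c₁ d * Y₁ + weight f L.toNetwork c₂ d * Y₂) := by
    intro d hd
    have := (tendsto_div_scale_succ hf hx.lam_tendsto hx.lam_ne (hx.tendsto d) (hx.eq_zero d)
      (p := p) (Y := fun i => Y (L.σ i d)) fun i => by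
        rcases hd i with h | h
        · rw [h, hYc₁]; exact hY₁
        · rw [h, hYc₂]; exact hY₂).1
    rwa [sum_input_eq_weight L.toNetwork hcne hd, hYc₁, hYc₂] at this
  have hneg := weighted_sums_neg h₁ h₂ h hY
  have hpos := mul_nonneg (hsign d' hd') (hsign d'' hd'')
  have := mul_neg_of_pos_of_neg (sq_pos_of_ne_zero hf.coeff_ne) hneg
  nlinarith

end Network

theorem IsDomain.zero_mem {D : Set ℝ} (hD : IsDomain D) : (0 : ℝ) ∈ D := by
  obtain ⟨l, hl, rfl | rfl | rfl⟩ := hD <;> simp [hl]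

theorem IsEquilibriumBranch.equilibriaAlong {k : ℕ} {C : Type*} {f : Family k} {N : Network k C}
    {D : Set ℝ} {b : ℝ → C → ℝ} (hb : IsEquilibriumBranch f N D b) {F : Ultrafilter ℝ}
    (hF : (F : Filter ℝ) ≤ 𝓝[D] 0) (h0 : ∀ᶠ l : ℝ in F, l ≠ 0) :
    EquilibriaAlong f N F id b where
  lam_ne := h0
  lam_tendsto := hF.trans nhdsWithin_le_nhds
  tendsto a := by
    have h : Tendsto b F (𝓝 (b 0)) :=
      (hb.continuousOn 0 hb.domain.zero_mem).tendsto.mono_left hF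
    rw [hb.zero_eq] at h
    exact tendsto_pi_nhds.1 h a
  eq_zero a := by
    have h : ∀ᶠ l in F, l ∈ D := hF self_mem_nhdsWithin
    exact h.mono fun l hl => congrFun (hb.field_eq l hl) a

end FeedForward

end

theorem mainTheorem12 {k : ℕ} {C C' : Type*} [Finite C] [Finite C']
    (N : FeedForward.FFN k C) (L : FeedForward.FFN k C')
    (j : ℕ) (hj : 1 < j) (hjm : j + 1 ≤ N.depth)
    (c : C) (c₁ c₂ : C')
    (hc : N.layer c = j) (hc₁ : L.layer c₁ = j) (hc₂ : L.layer c₂ = j)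
    (hsplit : FeedForward.IsSplit N.toNetwork c L.toNetwork {c₁, c₂})
    (hinside : FeedForward.IsLiftInsideLayer N L j) :
    FeedForward.Generically fun f : FeedForward.InternalFamily k =>
      (∃ d' d'' : C', L.layer d' = j + 1 ∧ L.layer d'' = j + 1 ∧
        (∀ i, L.σ i d' ∈ ({c₁, c₂} : Set C') ∧ L.σ i d'' ∈ ({c₁, c₂} : Set C')) ∧
        FeedForward.weight f.1 L.toNetwork c₁ d' * FeedForward.weight f.1 L.toNetwork c₁ d'' < 0 ∧
        FeedForward.weight f.1 L.toNetwork c₂ d' * FeedForward.weight f.1 L.toNetwork c₂ d'' < 0 ∧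
        FeedForward.weight f.1 L.toNetwork c₁ d' * FeedForward.weight f.1 L.toNetwork c₁ d'' +
            FeedForward.weight f.1 L.toNetwork c₂ d' * FeedForward.weight f.1 L.toNetwork c₂ d'' <
          FeedForward.weight f.1 L.toNetwork c₁ d' * FeedForward.weight f.1 L.toNetwork c₂ d'' +
            FeedForward.weight f.1 L.toNetwork c₁ d'' * FeedForward.weight f.1 L.toNetwork c₂ d') →
      ∀ (D : Set ℝ) (b : ℝ → C' → ℝ),
        FeedForward.IsBifurcationBranch f.1 L.toNetwork D b →
          FeedForward.IsLiftedFrom N.toNetwork L.toNetwork D b := by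
  refine (fun h => ?_) (FeedForward.Family.generically_nonDegenerate k L.depth)
  obtain ⟨G, hG, hGd, hGn⟩ := h
  refine ⟨G, hG, hGd, fun f hfG => ?_⟩
  rintro ⟨d', d'', -, -, hd, h₁, h₂, h⟩ D b ⟨hb, -⟩
  have hf := hGn f hfG
  obtain ⟨hbal, φ, -⟩ := hsplit
  obtain ⟨j, rfl⟩ : ∃ i, j = i + 1 := ⟨j - 1, by omega⟩
  have hσ : ∀ i, L.σ i c₁ = L.σ i c₂ := fun i => by
    refine (hbal i c₁ c₂ (Or.inr ⟨Or.inl rfl, Or.inr rfl⟩)).resolve_right fun hmem => ?_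
    have hl := L.σ_succ i c₁ j hc₁
    rcases hmem.1 with h | h <;> rw [h] at hl <;> omega
  have hk : Nonempty (Fin k) := by
    obtain ⟨-, i, -, -⟩ := N.exists_target c (by omega)
    exact ⟨i⟩
  refine ⟨_, hbal, ⟨φ⟩, ?_⟩
  have heq : ∀ᶠ lam in 𝓝[D] (0 : ℝ), b lam c₁ = b lam c₂ := by
    by_contra hcon
    obtain ⟨F, hF⟩ := Filter.exists_ultrafilter_iff.2 (Filter.frequently_iff_neBot.1 (Filter.not_eventually.1 hcon))
    have hF1 : (F : Filter ℝ) ≤ 𝓝[D] 0 := hF.trans inf_le_left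
    have hF2 : ∀ᶠ lam in F, ¬ b lam c₁ = b lam c₂ :=
      (hF.trans inf_le_right) (Filter.mem_principal_self _)
    have hx := hb.equilibriaAlong hF1 (hF2.mono fun lam hlam h0 => hlam (by
      rw [h0, hb.zero_eq]; rfl))
    have := hx.eventually_eq hf le_rfl hσ hc₁ (fun i => (hd i).1) (fun i => (hd i).2) h₁ h₂ h
    obtain ⟨lam, ha, hb⟩ := (this.and hF2).exists
    exact hb ha
  refine heq.mono fun lam hlam => ?_
  rintro a a' (rfl | ⟨rfl | rfl, rfl | rfl⟩)
  · rfl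
  · rfl
  · exact hlam
  · exact hlam.symm
  · rfl
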